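/- Let $n\ge 2$, and let $g=2\,dv\,du+h+2A\,du+H(du)^2$ be a smooth Walker metric on an open subset $U$ of $\mathbb{R}^{n+2}$ with coordinates $v,x^1,\dots,x^n,u$, where $h=h_{ij}(x,u)dx^idx^j$ is a $u$-dependent family of Riemannian metrics, $A=A_i(x,u)dx^i$ is a $u$-dependent family of one-forms, and $H$ is a function of all coordinates. Conventions: $R(X,Y)=\nabla_X\nabla_Y-\nabla_Y\nabla_X-\nabla_{[X,Y]}$; $\operatorname{Ric}(X,Y)=\operatorname{tr}(Z\mapsto R(Z,X)Y)$, also regarded as an endomorphism; $s=\operatorname{tr}\operatorname{Ric}$; $(X\wedge Y)Z=g(X,Z)Y-g(Y,Z)X$; for an endomorphism $L$, $R_L(X,Y)=LX\wedge Y+X\wedge LY$; in dimension $d\ge 3$ the Weyl tensor is $W=R+R_L$ with $L=\frac1{d-2}\bigl(\operatorname{Ric}-\frac{s}{2(d-1)}\mathrm{id}\bigr)$, and in dimension $2$ it is zero. Let $p=\partial_v$, $X_i=\partial_i-A_i\partial_v$, $q=\partial_u-\frac12H\partial_v$, and $E=\operatorname{span}\{X_1,\dots,X_n\}$, whose fibers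 are identified with the tangent spaces of the Riemannian metrics $h(u)$. Let $R_0$, $s_0$ and $W_0$ be the curvature tensor, the scalar curvature and the Weyl tensor of the metrics $h(u)$. Define the function $\lambda$, the section $\vec v$ of $E$, the section $P$ of $E^*\otimes\operatorname{End}(E)$ and the section $T$ of $\operatorname{End}(E)$ by $$\lambda=g(R(p,q)p,q),\quad g(\vec v,X)=-g(R(p,q)q,X),\quad g(P(X)Y,Z)=g(R(X,q)Y,Z),\quad g(T(X),Y)=-g(R(X,q)q,Y)$$ for $X,Y,Z\in\Gamma(E)$, and set $\widetilde{\operatorname{Ric}}P=h^{ij}P(X_i)X_j$. Then the Weyl tensor $W$ of $g$ vanishes on $U$ if and only if, on $U$, $$s_0=-n(n-1)\lambda,\qquad R_0=\tfrac12\lambda R_{\mathrm{id}},\qquad P(X)=\vec v\wedge X\ \text{ for all } X\in\Gamma(E),\qquad T=f\,\mathrm{id}_E\ \text{ for some function } f,$$ where $R_{\mathrm{id}}(X,Y)=2\,X\wedge Y$ on $E$. In particular, $W=0$ implies $\widetilde{\operatorname{Ric}}P=-(n-1)\vec v$ and $W_0=0$. -/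

import Mathlib

open scoped Matrix ContDiff

noncomputable section

/-! ### Pseudo-Riemannian geometry in one coordinate chart

`ι` indexes the coordinates, a point is a vector of coordinates, a tangent vector is given by its
components in the coordinate frame, and a metric `G` is a matrix-valued function. -/

namespace ChartGeometry

variable {ι : Type} [Fintype ι] [DecidableEq ι]

/-- The partial derivative `∂ᵢ f` at `x`. -/
def pderiv (i : ι) (f : (ι → ℝ) → ℝ) (x : ι → ℝ) : ℝ :=
  fderiv ℝ f x (Pi.single i 1)

/-- The value `g(X, Y)` of the bilinear form with matrix `g`. -/
def form (g : Matrix ι ι ℝ) (X Y : ι → ℝ) : ℝ := X ⬝ᵥ (g *ᵥ Y)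

/-- The Christoffel symbols `Γᵏᵢⱼ` of the Levi-Civita connection. -/
def christoffel (G : (ι → ℝ) → Matrix ι ι ℝ) (k i j : ι) (x : ι → ℝ) : ℝ :=
  (1 / 2) * ∑ l, (G x)⁻¹ k l *
    (pderiv i (fun y => G y j l) x + pderiv j (fun y => G y i l) x
      - pderiv l (fun y => G y i j) x)

/-- The components `Rˡₖᵢⱼ` of the curvature tensor: `R(∂ᵢ, ∂ⱼ) ∂ₖ = ∑ₗ Rˡₖᵢⱼ ∂ₗ`, where
`R(X, Y) = ∇_X ∇_Y - ∇_Y ∇_X - ∇_[X, Y]`. -/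
def riemann (G : (ι → ℝ) → Matrix ι ι ℝ) (l k i j : ι) (x : ι → ℝ) : ℝ :=
  pderiv i (christoffel G l j k) x - pderiv j (christoffel G l i k) x
    + ∑ m, (christoffel G l i m x * christoffel G m j k x
      - christoffel G l j m x * christoffel G m i k x)

/-- The curvature tensor `R(X, Y) Z` at the point `x`. -/
def curv (G : (ι → ℝ) → Matrix ι ι ℝ) (x : ι → ℝ) (X Y Z : ι → ℝ) : ι → ℝ :=
  fun l => ∑ k, ∑ i, ∑ j, riemann G l k i j x * Z k * X i * Y j

/-- The Ricci form `Ric(∂ⱼ, ∂ₖ) = tr (Z ↦ R(Z, ∂ⱼ) ∂ₖ)`. -/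
def ricciForm (G : (ι → ℝ) → Matrix ι ι ℝ) (x : ι → ℝ) : Matrix ι ι ℝ :=
  Matrix.of fun j k => ∑ i, riemann G i k i j x

/-- The Ricci operator, `g(Ric X, Y) = Ric(X, Y)`. -/
def ricci (G : (ι → ℝ) → Matrix ι ι ℝ) (x : ι → ℝ) : Matrix ι ι ℝ :=
  (G x)⁻¹ * ricciForm G x

/-- The scalar curvature. -/
def scalar (G : (ι → ℝ) → Matrix ι ι ℝ) (x : ι → ℝ) : ℝ := (ricci G x).trace

/-- The bivector `X ∧ Y` as a skew-symmetric endomorphism: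
`(X ∧ Y) Z = g(X, Z) Y - g(Y, Z) X`. -/
def wedge (g : Matrix ι ι ℝ) (X Y Z : ι → ℝ) : ι → ℝ :=
  form g X Z • Y - form g Y Z • X

/-- For an endomorphism `L`, the tensor `R_L(X, Y) = LX ∧ Y + X ∧ LY`. -/
def RL (g L : Matrix ι ι ℝ) (X Y Z : ι → ℝ) : ι → ℝ :=
  wedge g (L *ᵥ X) Y Z + wedge g X (L *ᵥ Y) Z

/-- The Schouten tensor `L = (Ric - s / (2 (d - 1)) id) / (d - 2)`, in dimension `d ≥ 3`. -/
def schouten (G : (ι → ℝ) → Matrix ι ι ℝ) (x : ι → ℝ) : Matrix ι ι ℝ :=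
  (1 / ((Fintype.card ι : ℝ) - 2)) •
    (ricci G x - (scalar G x / (2 * ((Fintype.card ι : ℝ) - 1))) • (1 : Matrix ι ι ℝ))

/-- The Weyl tensor `W = R + R_L`, `L` the Schouten tensor; as usual it is zero by convention
in dimensions at most two, where the Schouten tensor is not defined. -/
def weyl (G : (ι → ℝ) → Matrix ι ι ℝ) (x : ι → ℝ) (X Y Z : ι → ℝ) : ι → ℝ :=
  if Fintype.card ι ≤ 2 then 0
  else curv G x X Y Z + RL (G x) (schouten G x) X Y Z

end ChartGeometry

/-! ### Walker metrics -/

/-- The index set of the coordinates `v, x¹, …, xⁿ, u`, in this order. -/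
abbrev WalkerIdx (n : ℕ) : Type := Unit ⊕ Fin n ⊕ Unit

namespace WalkerIdx

/-- The index of the coordinate `v`. -/
abbrev v {n : ℕ} : WalkerIdx n := Sum.inl ()

/-- The index of the coordinate `xⁱ`. -/
abbrev x {n : ℕ} (i : Fin n) : WalkerIdx n := Sum.inr (Sum.inl i)

/-- The index of the coordinate `u`. -/
abbrev u {n : ℕ} : WalkerIdx n := Sum.inr (Sum.inr ())

end WalkerIdx

/-- The coordinates `(x¹, …, xⁿ)` of a point `(v, x¹, …, xⁿ, u)`. -/
def xPart {n : ℕ} (z : WalkerIdx n → ℝ) : Fin n → ℝ := fun i => z (WalkerIdx.x i)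

/-- The coordinate `u` of a point `(v, x¹, …, xⁿ, u)`. -/
def uPart {n : ℕ} (z : WalkerIdx n → ℝ) : ℝ := z WalkerIdx.u

/-- The data of a smooth Walker metric `g = 2 dv du + h + 2 A du + H (du)²` on an open set `U` of
`ℝⁿ⁺²` with coordinates `v, x¹, …, xⁿ, u`: a `u`-dependent family of Riemannian metrics
`h = h_{ij}(x, u) dxⁱ dxʲ`, a `u`-dependent family of one-forms `A = A_i(x, u) dxⁱ`, and a function
`H` of all the coordinates. -/
structure WalkerMetric (n : ℕ) where
  U : Set (WalkerIdx n → ℝ)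
  h : (Fin n → ℝ) → ℝ → Matrix (Fin n) (Fin n) ℝ
  A : (Fin n → ℝ) → ℝ → (Fin n → ℝ)
  H : (WalkerIdx n → ℝ) → ℝ
  isOpen_U : IsOpen U
  smooth_h : ∀ i j, ContDiffOn ℝ ∞ (fun z => h (xPart z) (uPart z) i j) U
  smooth_A : ∀ i, ContDiffOn ℝ ∞ (fun z => A (xPart z) (uPart z) i) U
  smooth_H : ContDiffOn ℝ ∞ H U
  posDef_h : ∀ z ∈ U, (h (xPart z) (uPart z)).PosDef

namespace WalkerMetric

open ChartGeometry

variable {n : ℕ} (M : WalkerMetric n)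

/-- The matrix of the metric `g = 2 dv du + h + 2 A du + H (du)²` in the coordinates. -/
def metric (z : WalkerIdx n → ℝ) : Matrix (WalkerIdx n) (WalkerIdx n) ℝ :=
  Matrix.of fun a b =>
    match a, b with
    | Sum.inl _, Sum.inl _ => 0
    | Sum.inl _, Sum.inr (Sum.inl _) => 0
    | Sum.inl _, Sum.inr (Sum.inr _) => 1
    | Sum.inr (Sum.inl _), Sum.inl _ => 0
    | Sum.inr (Sum.inl i), Sum.inr (Sum.inl j) => M.h (xPart z) (uPart z) i j
    | Sum.inr (Sum.inl i), Sum.inr (Sum.inr _) => M.A (xPart z) (uPart z) i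
    | Sum.inr (Sum.inr _), Sum.inl _ => 1
    | Sum.inr (Sum.inr _), Sum.inr (Sum.inl j) => M.A (xPart z) (uPart z) j
    | Sum.inr (Sum.inr _), Sum.inr (Sum.inr _) => M.H z

/-- The frame field `p = ∂_v`. -/
def p : WalkerIdx n → ℝ := Pi.single WalkerIdx.v 1

/-- The frame field `q = ∂_u - (H / 2) ∂_v`. -/
def q (z : WalkerIdx n → ℝ) : WalkerIdx n → ℝ :=
  Pi.single WalkerIdx.u 1 - (M.H z / 2) • Pi.single WalkerIdx.v 1

/-- The frame fields `Xᵢ = ∂ᵢ - Aᵢ ∂_v`, which span the distribution `E`. -/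
def frame (z : WalkerIdx n → ℝ) (i : Fin n) : WalkerIdx n → ℝ :=
  Pi.single (WalkerIdx.x i) 1 - M.A (xPart z) (uPart z) i • Pi.single WalkerIdx.v 1

/-- The vector `∑ᵢ aⁱ Xᵢ` of `E` with components `a`. Vectors of `E` are given by their components
below; in this way `E` is identified with the tangent spaces of the metrics `h(u)`. -/
def vec (z : WalkerIdx n → ℝ) (a : Fin n → ℝ) : WalkerIdx n → ℝ := ∑ i, a i • M.frame z i

/-- The matrix `h_{ij} = g(Xᵢ, Xⱼ)` at the point `z`. -/
def hAt (z : WalkerIdx n → ℝ) : Matrix (Fin n) (Fin n) ℝ := M.h (xPart z) (uPart z)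

/-- The components of the `g`-orthogonal projection of a tangent vector `Y` to `E`: the vector of
`E` whose product with each `Xᵢ` is `g(Y, Xᵢ)`. -/
def projE (z : WalkerIdx n → ℝ) (Y : WalkerIdx n → ℝ) : Fin n → ℝ :=
  (M.hAt z)⁻¹ *ᵥ fun i => form (M.metric z) Y (M.frame z i)

/-- The curvature tensor `R(X, Y) Z` of `g`. -/
def R (z : WalkerIdx n → ℝ) (X Y Z : WalkerIdx n → ℝ) : WalkerIdx n → ℝ :=
  curv M.metric z X Y Z

/-- The Weyl tensor `W(X, Y) Z` of `g`. -/
def W (z : WalkerIdx n → ℝ) (X Y Z : WalkerIdx n → ℝ) : WalkerIdx n → ℝ :=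
  weyl M.metric z X Y Z

/-- The function `λ`: the component `g(R(p, q) p, q)`, so that `R(p, q) = -λ p ∧ q - p ∧ v⃗`. -/
def lam (z : WalkerIdx n → ℝ) : ℝ :=
  form (M.metric z) (M.R z p (M.q z) p) (M.q z)

/-- The section `v⃗` of `E`: `g(v⃗, X) = -g(R(p, q) q, X)`, so that
`R(p, q) = -λ p ∧ q - p ∧ v⃗`. -/
def vecv (z : WalkerIdx n → ℝ) : Fin n → ℝ :=
  -M.projE z (M.R z p (M.q z) (M.q z))

/-- The tensor `P`: `g(P(X) Y, Z) = g(R(X, q) Y, Z)` on `E`. -/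
def P (z : WalkerIdx n → ℝ) (X Y : Fin n → ℝ) : Fin n → ℝ :=
  M.projE z (M.R z (M.vec z X) (M.q z) (M.vec z Y))

/-- The tensor `T`: `g(T(X), Y) = -g(R(X, q) q, Y)` on `E`. -/
def T (z : WalkerIdx n → ℝ) (X : Fin n → ℝ) : Fin n → ℝ :=
  -M.projE z (M.R z (M.vec z X) (M.q z) (M.q z))

/-- `Ric~ P = h^{ij} P(Xᵢ) Xⱼ`. -/
def ricP (z : WalkerIdx n → ℝ) : Fin n → ℝ :=
  ∑ i, ∑ j, (M.hAt z)⁻¹ i j • M.P z (Pi.single i 1) (Pi.single j 1)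

/-- The curvature tensor `R₀` of the Riemannian metric `h(u)`, with `u = u(z)`. -/
def R₀ (z : WalkerIdx n → ℝ) (X Y Z : Fin n → ℝ) : Fin n → ℝ :=
  curv (fun y => M.h y (uPart z)) (xPart z) X Y Z

/-- The scalar curvature `s₀` of the Riemannian metric `h(u)`, with `u = u(z)`. -/
def s₀ (z : WalkerIdx n → ℝ) : ℝ := scalar (fun y => M.h y (uPart z)) (xPart z)

/-- The Weyl tensor `W₀` of the Riemannian metric `h(u)`, with `u = u(z)`. -/
def W₀ (z : WalkerIdx n → ℝ) (X Y Z : Fin n → ℝ) : Fin n → ℝ :=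
  weyl (fun y => M.h y (uPart z)) (xPart z) X Y Z

end WalkerMetric

end

/-! The statement is pointwise: at each point both sides concern the components `K a b c d =
g(R(e_a, e_b) e_c, e_d)` in the frame `p, X₁, …, Xₙ, q`, whose Gram matrix is `nullGram h`.

Geometry supplies three facts about `K`. It has the usual curvature symmetries
(`lowerRiemann_antisymm_right`, `lowerRiemann_pair_symm`). The null line of `p` is parallel, so
`R(X, Y) p` is a multiple of `p`, which kills all components with `p` and some `Xᵢ` in one skew pair
(`riemann_v`, `isWalkerCurvature_frameCurv`). The components along `E` alone are those of `R₀`,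
because `∇` differs from the connection of `h(u)` along a slice only by multiples of `p`
(`riemann_x_x_x_x`, `frameCurv_x_x_x_x`). Hence `K` is determined by `λ`, `v⃗`, `R₀`, `P` and `T`.

The rest is algebra. If `W = 0`, treat the Schouten components as unknowns: the equations for
`(p,q,p,q)`, `(p,Xᵢ,Xⱼ,q)` and `(p,q,q,Xₖ)` express them through `λ` and `v⃗`, except the `q, q`
one, and the remaining equations then read off `R₀`, `P` and `T`, the free component giving the
factor of `T` (`of_frameWeyl_eq_zero`). Conversely the stated forms fix every component of `K`;
computing the Ricci and Schouten tensors from them gives `W = 0` by inspection of all components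
(`frameWeyl_eq_zero`).

The scalar curvature condition is the double trace of the one on `R₀`. Tracing the form of `P` gives
`ricP`, and constant curvature of `h(u)` gives `W₀ = 0`. -/

noncomputable section

namespace ChartGeometry

open Filter Topology

variable {ι : Type} [Fintype ι] [DecidableEq ι]

/-! ### Partial derivatives -/

section Pderiv

variable {f g : (ι → ℝ) → ℝ} {x : ι → ℝ} (i : ι)

omit [Fintype ι] in
theorem pderiv_congr (h : f =ᶠ[𝓝 x] g) : pderiv i f x = pderiv i g x := by
  rw [pderiv, pderiv, h.fderiv_eq]

theorem pderiv_add (hf : DifferentiableAt ℝ f x) (hg : DifferentiableAt ℝ g x) :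
    pderiv i (fun y => f y + g y) x = pderiv i f x + pderiv i g x := by
  simp [pderiv, fderiv_fun_add hf hg]

theorem pderiv_mul (hf : DifferentiableAt ℝ f x) (hg : DifferentiableAt ℝ g x) :
    pderiv i (fun y => f y * g y) x = pderiv i f x * g x + f x * pderiv i g x := by
  simp [pderiv, fderiv_fun_mul hf hg]
  ring

theorem pderiv_sum {κ : Type*} {s : Finset κ} {F : κ → (ι → ℝ) → ℝ}
    (hF : ∀ k ∈ s, DifferentiableAt ℝ (F k) x) :
    pderiv i (fun y => ∑ k ∈ s, F k y) x = ∑ k ∈ s, pderiv i (F k) x := by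
  simp [pderiv, fderiv_fun_sum hF]

omit [Fintype ι] in
theorem pderiv_const (c : ℝ) : pderiv i (fun _ => c) x = 0 := by
  simp [pderiv]

/-- Differentiability is not needed: where it fails, `fderiv` is zero by convention. -/
theorem pderiv_eq_zero_of_translation_invariant
    (h : ∀ t : ℝ, f (x + t • Pi.single i 1) = f x) : pderiv i f x = 0 := by
  by_cases hf : DifferentiableAt ℝ f x
  · rw [pderiv, ← hf.lineDeriv_eq_fderiv, lineDeriv]
    simp [h]
  · simp [pderiv, fderiv_zero_of_not_differentiableAt hf]

theorem differentiableAt_pderiv {U : Set (ι → ℝ)} (hU : IsOpen U) (hf : ContDiffOn ℝ ∞ f U)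
    (hx : x ∈ U) : DifferentiableAt ℝ (pderiv i f) x := by
  have h : ContDiffOn ℝ 1 (fderiv ℝ f) U := hf.fderiv_of_isOpen hU (by norm_cast)
  exact ((h.differentiableOn (by norm_num)).differentiableAt (hU.mem_nhds hx)).clm_apply
    (differentiableAt_const _)

theorem pderiv_comm (hf : ContDiffAt ℝ ∞ f x) (i j : ι) :
    pderiv i (pderiv j f) x = pderiv j (pderiv i f) x := by
  have hd : DifferentiableAt ℝ (fderiv ℝ f) x :=
    (hf.fderiv_right (m := 1) (by norm_cast)).differentiableAt (by norm_num)
  have key : ∀ a b : ι, pderiv a (pderiv b f) x =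
      fderiv ℝ (fderiv ℝ f) x (Pi.single a 1) (Pi.single b 1) := by
    intro a b
    change fderiv ℝ (fun y => fderiv ℝ f y (Pi.single b 1)) x _ = _
    rw [fderiv_clm_apply hd (differentiableAt_const _)]
    simp
  rw [key, key]
  exact (hf.isSymmSndFDerivAt (by simpa using (by norm_cast : (2 : ℕ∞ω) ≤ ∞))).eq _ _

end Pderiv

/-! ### Metrics on an open set -/

/-- `G` is a smooth pseudo-Riemannian metric on the open set `U`. -/
structure IsMetricOn (G : (ι → ℝ) → Matrix ι ι ℝ) (U : Set (ι → ℝ)) : Prop where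
  isOpen : IsOpen U
  symm : ∀ y ∈ U, ∀ i j, G y i j = G y j i
  isUnit_det : ∀ y ∈ U, IsUnit (G y).det
  smooth : ∀ i j, ContDiffOn ℝ ∞ (fun y => G y i j) U

/-- The components `g(R(∂ᵢ, ∂ⱼ) ∂ₖ, ∂ₗ)` of the curvature tensor. -/
def lowerRiemann (G : (ι → ℝ) → Matrix ι ι ℝ) (x : ι → ℝ) (i j k l : ι) : ℝ :=
  ∑ m, G x l m * riemann G m k i j x

/-- The Christoffel symbols of the first kind `Γₗᵢⱼ`. -/
def lowerChristoffel (G : (ι → ℝ) → Matrix ι ι ℝ) (l i j : ι) (x : ι → ℝ) : ℝ :=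
  (1 / 2) * (pderiv i (fun y => G y j l) x + pderiv j (fun y => G y i l) x
      - pderiv l (fun y => G y i j) x)

theorem christoffel_eq_sum (G : (ι → ℝ) → Matrix ι ι ℝ) (k i j : ι) (x : ι → ℝ) :
    christoffel G k i j x = ∑ l, (G x)⁻¹ k l * lowerChristoffel G l i j x := by
  simp only [christoffel, lowerChristoffel, Finset.mul_sum]
  exact Finset.sum_congr rfl fun l _ => by ring

theorem riemann_antisymm (G : (ι → ℝ) → Matrix ι ι ℝ) (l k i j : ι) (x : ι → ℝ) :
    riemann G l k j i x = -riemann G l k i j x := by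
  simp only [riemann, Finset.sum_sub_distrib]
  ring

namespace IsMetricOn

variable {G : (ι → ℝ) → Matrix ι ι ℝ} {U : Set (ι → ℝ)} (hG : IsMetricOn G U)
  {x : ι → ℝ} (hx : x ∈ U)

include hG hx

theorem mem_nhds : U ∈ 𝓝 x := hG.isOpen.mem_nhds hx

theorem contDiffAt (i j : ι) : ContDiffAt ℝ ∞ (fun y => G y i j) x :=
  (hG.smooth i j).contDiffAt (hG.mem_nhds hx)

theorem differentiableAt (i j : ι) : DifferentiableAt ℝ (fun y => G y i j) x :=
  (hG.contDiffAt hx i j).differentiableAt (by norm_num)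

theorem pderiv_symm (l i j : ι) :
    pderiv l (fun y => G y i j) x = pderiv l (fun y => G y j i) x :=
  pderiv_congr l (by filter_upwards [hG.mem_nhds hx] with y hy using hG.symm y hy i j)

theorem lowerChristoffel_symm (l i j : ι) :
    lowerChristoffel G l i j x = lowerChristoffel G l j i x := by
  simp only [lowerChristoffel, hG.pderiv_symm hx l i j]
  ring

theorem christoffel_symm (l i j : ι) : christoffel G l i j x = christoffel G l j i x := by
  simp only [christoffel_eq_sum, hG.lowerChristoffel_symm hx _ i j]

theorem pderiv_christoffel_symm (m l i j : ι) :
    pderiv m (christoffel G l i j) x = pderiv m (christoffel G l j i) x :=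
  pderiv_congr m (by
    filter_upwards [hG.mem_nhds hx] with y hy using hG.christoffel_symm hy l i j)

/-- The first Bianchi identity. -/
theorem riemann_cyclic (l i j k : ι) :
    riemann G l k i j x + riemann G l i j k x + riemann G l j k i x = 0 := by
  simp only [riemann, Finset.sum_sub_distrib, hG.christoffel_symm hx _ k j,
    hG.christoffel_symm hx _ k i, hG.christoffel_symm hx _ j i,
    hG.pderiv_christoffel_symm hx _ _ k j, hG.pderiv_christoffel_symm hx _ _ k i,
    hG.pderiv_christoffel_symm hx _ _ j i]
  ring

theorem differentiableAt_lowerChristoffel (l i j : ι) :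
    DifferentiableAt ℝ (lowerChristoffel G l i j) x :=
  (((differentiableAt_pderiv _ hG.isOpen (hG.smooth _ _) hx).add
    (differentiableAt_pderiv _ hG.isOpen (hG.smooth _ _) hx)).sub
    (differentiableAt_pderiv _ hG.isOpen (hG.smooth _ _) hx)).const_mul _

/-- Cramer's rule: the adjugate and the determinant are polynomial in the entries. -/
theorem differentiableAt_inv (i j : ι) : DifferentiableAt ℝ (fun y => (G y)⁻¹ i j) x := by
  have hdet : ∀ A : (ι → ℝ) → Matrix ι ι ℝ, (∀ a b, DifferentiableAt ℝ (fun y => A y a b) x) →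
      DifferentiableAt ℝ (fun y => (A y).det) x := by
    intro A hA
    simp only [Matrix.det_apply, zsmul_eq_mul, Units.smul_def]
    refine DifferentiableAt.fun_sum fun σ _ => DifferentiableAt.const_mul ?_ _
    fun_prop
  have hadj : DifferentiableAt ℝ (fun y => (G y).adjugate i j) x := by
    simp only [Matrix.adjugate_apply]
    refine hdet _ fun a b => ?_
    by_cases h : a = j
    · simp [Matrix.updateRow_apply, h]
    · simpa [Matrix.updateRow_apply, h] using hG.differentiableAt hx a b
  have hne : (G x).det ≠ 0 := (hG.isUnit_det x hx).ne_zero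
  simp only [Matrix.inv_def, Ring.inverse_eq_inv', Matrix.smul_apply, smul_eq_mul]
  exact ((hdet G (hG.differentiableAt hx)).inv hne).mul hadj

theorem differentiableAt_christoffel (l i j : ι) :
    DifferentiableAt ℝ (christoffel G l i j) x := by
  have : christoffel G l i j =
      fun y => ∑ m, (G y)⁻¹ l m * lowerChristoffel G m i j y :=
    funext (christoffel_eq_sum G l i j)
  rw [this]
  exact DifferentiableAt.fun_sum fun m _ =>
    (hG.differentiableAt_inv hx l m).mul (hG.differentiableAt_lowerChristoffel hx m i j)

theorem sum_mul_christoffel (l i j : ι) :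
    ∑ m, G x l m * christoffel G m i j x = lowerChristoffel G l i j x := by
  have h : (fun m => christoffel G m i j x) = (G x)⁻¹ *ᵥ fun m => lowerChristoffel G m i j x :=
    funext fun k => christoffel_eq_sum G k i j x
  change (G x *ᵥ fun m => christoffel G m i j x) l = _
  rw [h, Matrix.mulVec_mulVec, Matrix.mul_nonsing_inv _ (hG.isUnit_det x hx), Matrix.one_mulVec]

theorem pderiv_eq_lowerChristoffel_add (k i j : ι) :
    pderiv k (fun y => G y i j) x = lowerChristoffel G i k j x + lowerChristoffel G j k i x := by
  simp only [lowerChristoffel, hG.pderiv_symm hx _ j i, hG.pderiv_symm hx _ k i,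
    hG.pderiv_symm hx _ k j]
  ring

/-- Product rule applied to the lowering of the index of `Γ`, with the derivative of the metric
rewritten by metric compatibility. -/
theorem sum_mul_pderiv_christoffel (a l i j : ι) :
    ∑ m, G x l m * pderiv a (christoffel G m i j) x = pderiv a (lowerChristoffel G l i j) x
      - ∑ m, (lowerChristoffel G l a m x + lowerChristoffel G m a l x)
        * christoffel G m i j x := by
  have h : pderiv a (lowerChristoffel G l i j) x =
      pderiv a (fun y => ∑ m, G y l m * christoffel G m i j y) x :=
    pderiv_congr a (by
      filter_upwards [hG.mem_nhds hx] with y hy using (hG.sum_mul_christoffel hy l i j).symm)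
  rw [h, pderiv_sum a fun m _ =>
    (hG.differentiableAt hx l m).fun_mul (hG.differentiableAt_christoffel hx m i j)]
  simp only [pderiv_mul a (hG.differentiableAt hx l _) (hG.differentiableAt_christoffel hx _ i j),
    Finset.sum_add_distrib, ← hG.pderiv_eq_lowerChristoffel_add hx]
  ring

/-- Lowering the index under the derivative produces two kinds of products; one kind cancels the
quadratic part of the curvature. What remains makes the skew-symmetry in `k, l` visible. -/
theorem lowerRiemann_eq (i j k l : ι) :
    lowerRiemann G x i j k l =
      pderiv i (lowerChristoffel G l j k) x - pderiv j (lowerChristoffel G l i k) x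
        - ∑ m, lowerChristoffel G m i l x * christoffel G m j k x
        + ∑ m, lowerChristoffel G m j l x * christoffel G m i k x := by
  have h : ∀ a b c : ι, ∑ m, G x l m * ∑ p, christoffel G m a p x * christoffel G p b c x =
      ∑ p, lowerChristoffel G l a p x * christoffel G p b c x := by
    intro a b c
    simp only [Finset.mul_sum]
    rw [Finset.sum_comm]
    refine Finset.sum_congr rfl fun p _ => ?_
    rw [← hG.sum_mul_christoffel hx, Finset.sum_mul]
    exact Finset.sum_congr rfl fun m _ => by ring
  simp only [lowerRiemann, riemann, mul_add, mul_sub, Finset.sum_add_distrib,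
    Finset.sum_sub_distrib, h, hG.sum_mul_pderiv_christoffel hx, add_mul]
  ring

theorem sum_lowerChristoffel_mul_christoffel (i j k l : ι) :
    ∑ m, lowerChristoffel G m i j x * christoffel G m k l x =
      ∑ m, lowerChristoffel G m k l x * christoffel G m i j x := by
  simp only [← hG.sum_mul_christoffel hx, Finset.sum_mul]
  rw [Finset.sum_comm]
  refine Finset.sum_congr rfl fun p _ => Finset.sum_congr rfl fun m _ => ?_
  rw [hG.symm x hx]
  ring

omit hG hx in
theorem lowerRiemann_antisymm_left (i j k l : ι) :
    lowerRiemann G x j i k l = -lowerRiemann G x i j k l := by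
  simp only [lowerRiemann, riemann_antisymm G _ k i j, mul_neg, Finset.sum_neg_distrib]

/-- Symmetrizing in `k, l` turns the derivative terms into `∂ᵢ∂ⱼ g - ∂ⱼ∂ᵢ g`, which vanishes; the
quadratic terms cancel because the pairing of two Christoffel symbols is symmetric. -/
theorem lowerRiemann_antisymm_right (i j k l : ι) :
    lowerRiemann G x i j l k = -lowerRiemann G x i j k l := by
  have h : ∀ a b : ι, pderiv a (lowerChristoffel G l b k) x + pderiv a (lowerChristoffel G k b l) x
      = pderiv a (pderiv b (fun y => G y l k)) x := by
    intro a b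
    rw [← pderiv_add a (hG.differentiableAt_lowerChristoffel hx _ _ _)
      (hG.differentiableAt_lowerChristoffel hx _ _ _)]
    exact pderiv_congr a (by
      filter_upwards [hG.mem_nhds hx] with y hy
        using (hG.pderiv_eq_lowerChristoffel_add hy b l k).symm)
  have h1 := h i j
  have h2 := h j i
  rw [pderiv_comm (hG.contDiffAt hx l k) i j] at h1
  rw [hG.lowerRiemann_eq hx, hG.lowerRiemann_eq hx,
    hG.sum_lowerChristoffel_mul_christoffel hx i k, hG.sum_lowerChristoffel_mul_christoffel hx j k]
  linarith

theorem lowerRiemann_cyclic (i j k l : ι) :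
    lowerRiemann G x i j k l + lowerRiemann G x j k i l + lowerRiemann G x k i j l = 0 := by
  simp only [lowerRiemann, ← Finset.sum_add_distrib, ← mul_add, hG.riemann_cyclic hx, mul_zero,
    Finset.sum_const_zero]

/-- The classical argument: a signed combination of the four Bianchi identities obtained by rotating
`i, j, k, l`, reduced by the two skew-symmetries. -/
theorem lowerRiemann_pair_symm (i j k l : ι) :
    lowerRiemann G x i j k l = lowerRiemann G x k l i j := by
  have b1 := hG.lowerRiemann_cyclic hx i j k l
  have b2 := hG.lowerRiemann_cyclic hx j k l i
  have b3 := hG.lowerRiemann_cyclic hx k l i j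
  have b4 := hG.lowerRiemann_cyclic hx l i j k
  have s := lowerRiemann_antisymm_left (G := G) (x := x)
  have t := hG.lowerRiemann_antisymm_right hx
  linarith [s i j k l, t i j k l, s j k i l, t j k i l, s k i j l, t k i j l, s k l i j, t k l i j,
    s l j k i, t l j k i, s l i j k, t l i j k, s i k l j, t i k l j, s j l i k, t j l i k,
    s i j l k, s j k l i, s k l j i, s l i k j, s i k j l, s j l k i]

end IsMetricOn

end ChartGeometry

/-! ### Multilinear forms are determined by their values on the standard basis -/

section Linear

variable {κ : Type} [Fintype κ] [DecidableEq κ]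

theorem IsLinearMap.eq_zero_of_single {f : (κ → ℝ) → ℝ} (hf : IsLinearMap ℝ f)
    (h : ∀ i, f (Pi.single i 1) = 0) (x : κ → ℝ) : f x = 0 := by
  have : hf.mk' f = 0 := LinearMap.pi_ext' fun i => LinearMap.ext_ring (by simpa using h i)
  exact congrArg (fun g => g x) this

theorem trilinear_eq_zero_of_single {B : (κ → ℝ) → (κ → ℝ) → (κ → ℝ) → ℝ}
    (h₁ : ∀ Y Z, IsLinearMap ℝ fun X => B X Y Z)
    (h₂ : ∀ X Z, IsLinearMap ℝ fun Y => B X Y Z)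
    (h₃ : ∀ X Y, IsLinearMap ℝ fun Z => B X Y Z)
    (h : ∀ i j k, B (Pi.single i 1) (Pi.single j 1) (Pi.single k 1) = 0) (X Y Z : κ → ℝ) :
    B X Y Z = 0 :=
  (h₁ Y Z).eq_zero_of_single (fun _ => (h₂ _ Z).eq_zero_of_single (fun _ =>
    (h₃ _ _).eq_zero_of_single (fun _ => h _ _ _) Z) Y) X

theorem quadrilinear_eq_zero_of_single {B : (κ → ℝ) → (κ → ℝ) → (κ → ℝ) → (κ → ℝ) → ℝ}
    (h₁ : ∀ Y Z V, IsLinearMap ℝ fun X => B X Y Z V)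
    (h₂ : ∀ X Z V, IsLinearMap ℝ fun Y => B X Y Z V)
    (h₃ : ∀ X Y V, IsLinearMap ℝ fun Z => B X Y Z V)
    (h₄ : ∀ X Y Z, IsLinearMap ℝ fun V => B X Y Z V)
    (h : ∀ i j k l, B (Pi.single i 1) (Pi.single j 1) (Pi.single k 1) (Pi.single l 1) = 0)
    (X Y Z V : κ → ℝ) : B X Y Z V = 0 :=
  (h₁ Y Z V).eq_zero_of_single (fun _ => trilinear_eq_zero_of_single
    (fun Z V => h₂ _ Z V) (fun Y V => h₃ _ Y V) (fun Y Z => h₄ _ Y Z) (fun _ _ _ => h _ _ _ _)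
    Y Z V) X

end Linear

/-! ### Multilinearity and symmetries of the curvature form on arbitrary vectors. -/

namespace ChartGeometry

variable {ι : Type} [Fintype ι] [DecidableEq ι]

section Form

variable (g : Matrix ι ι ℝ) (X X' Y Y' Z : ι → ℝ) (c : ℝ)

omit [DecidableEq ι] in
theorem form_add_left : form g (X + X') Y = form g X Y + form g X' Y := by
  simp [form, add_dotProduct]

omit [DecidableEq ι] in
theorem form_sub_left : form g (X - X') Y = form g X Y - form g X' Y := by
  simp [form, sub_dotProduct]

omit [DecidableEq ι] in
theorem form_neg_left : form g (-X) Y = -form g X Y := by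
  simp [form]

omit [DecidableEq ι] in
theorem form_smul_left : form g (c • X) Y = c * form g X Y := by
  simp [form]

omit [DecidableEq ι] in
theorem form_zero_left : form g 0 Y = 0 := by
  simp [form]

omit [DecidableEq ι] in
theorem form_add_right : form g X (Y + Y') = form g X Y + form g X Y' := by
  simp [form, Matrix.mulVec_add, dotProduct_add]

omit [DecidableEq ι] in
theorem form_sub_right : form g X (Y - Y') = form g X Y - form g X Y' := by
  simp [form, Matrix.mulVec_sub, dotProduct_sub]

omit [DecidableEq ι] in
theorem form_smul_right : form g X (c • Y) = c * form g X Y := by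
  simp [form, Matrix.mulVec_smul]

omit [DecidableEq ι] in
theorem form_sum_left {κ : Type*} (s : Finset κ) (F : κ → ι → ℝ) :
    form g (∑ k ∈ s, F k) Y = ∑ k ∈ s, form g (F k) Y := by
  simp [form, sum_dotProduct]

omit [DecidableEq ι] in
theorem form_sum_right {κ : Type*} (s : Finset κ) (F : κ → ι → ℝ) :
    form g X (∑ k ∈ s, F k) = ∑ k ∈ s, form g X (F k) := by
  simp [form, Matrix.mulVec_sum, dotProduct_sum]

variable {g}

omit [DecidableEq ι] in
theorem form_symm (hg : ∀ i j, g i j = g j i) : form g X Y = form g Y X := by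
  have h : gᵀ = g := by ext i j; exact hg j i
  rw [form, form, ← Matrix.vecMul_transpose, h, dotProduct_comm, ← Matrix.dotProduct_mulVec]

variable (g) in
theorem form_single_single (i j : ι) : form g (Pi.single i 1) (Pi.single j 1) = g i j := by
  simp [form]

theorem eq_of_form_single_eq (hg : IsUnit g.det)
    (h : ∀ i, form g X (Pi.single i 1) = form g Y (Pi.single i 1)) : X = Y := by
  have h1 : (X - Y) ᵥ* g = 0 := by
    rw [Matrix.sub_vecMul, sub_eq_zero]
    ext i
    simpa only [form, Matrix.dotProduct_mulVec, dotProduct_single, mul_one]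
      using h i
  have h2 := congrArg (· ᵥ* g⁻¹) h1
  simpa [Matrix.vecMul_vecMul, Matrix.mul_nonsing_inv _ hg, sub_eq_zero] using h2

theorem eq_of_form_eq (hg : IsUnit g.det) (h : ∀ V, form g X V = form g Y V) : X = Y :=
  eq_of_form_single_eq X Y hg fun _ => h _

end Form

section Wedge

variable (g L : Matrix ι ι ℝ) (X Y Z V : ι → ℝ)

omit [DecidableEq ι] in
theorem form_wedge : form g (wedge g X Y Z) V =
    form g X Z * form g Y V - form g Y Z * form g X V := by
  simp [wedge, form_sub_left, form_smul_left]

omit [DecidableEq ι] in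
theorem form_RL : form g (RL g L X Y Z) V =
    form g (L *ᵥ X) Z * form g Y V - form g Y Z * form g (L *ᵥ X) V
      + (form g X Z * form g (L *ᵥ Y) V - form g (L *ᵥ Y) Z * form g X V) := by
  simp [RL, form_add_left, form_wedge]

end Wedge

section Curv

variable (G : (ι → ℝ) → Matrix ι ι ℝ) (x X X' Y Y' Z Z' : ι → ℝ) (c : ℝ)

theorem curv_add_left : curv G x (X + X') Y Z = curv G x X Y Z + curv G x X' Y Z := by
  ext l
  simp only [curv, Pi.add_apply, ← Finset.sum_add_distrib, mul_add, add_mul]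

theorem curv_smul_left : curv G x (c • X) Y Z = c • curv G x X Y Z := by
  ext l
  simp only [curv, Pi.smul_apply, smul_eq_mul, Finset.mul_sum]
  exact Finset.sum_congr rfl fun _ _ => Finset.sum_congr rfl fun _ _ =>
    Finset.sum_congr rfl fun _ _ => by ring

theorem curv_add_middle : curv G x X (Y + Y') Z = curv G x X Y Z + curv G x X Y' Z := by
  ext l
  simp only [curv, Pi.add_apply, ← Finset.sum_add_distrib, mul_add]

theorem curv_smul_middle : curv G x X (c • Y) Z = c • curv G x X Y Z := by
  ext l
  simp only [curv, Pi.smul_apply, smul_eq_mul, Finset.mul_sum]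
  exact Finset.sum_congr rfl fun _ _ => Finset.sum_congr rfl fun _ _ =>
    Finset.sum_congr rfl fun _ _ => by ring

theorem curv_add_right : curv G x X Y (Z + Z') = curv G x X Y Z + curv G x X Y Z' := by
  ext l
  simp only [curv, Pi.add_apply, ← Finset.sum_add_distrib, mul_add, add_mul]

theorem curv_smul_right : curv G x X Y (c • Z) = c • curv G x X Y Z := by
  ext l
  simp only [curv, Pi.smul_apply, smul_eq_mul, Finset.mul_sum]
  exact Finset.sum_congr rfl fun _ _ => Finset.sum_congr rfl fun _ _ =>
    Finset.sum_congr rfl fun _ _ => by ring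

theorem curv_single (i j k l : ι) :
    curv G x (Pi.single i 1) (Pi.single j 1) (Pi.single k 1) l = riemann G l k i j x := by
  simp [curv, Pi.single_apply]

theorem sum_curv_single_eq_ricciForm :
    ∑ i, curv G x (Pi.single i 1) Y Z i = Y ⬝ᵥ (ricciForm G x *ᵥ Z) := by
  simp only [curv, ricciForm, dotProduct, Matrix.mulVec, Matrix.of_apply, Pi.single_apply,
    mul_ite, ite_mul, mul_one, mul_zero, zero_mul, Finset.sum_ite_irrel, Finset.sum_const_zero,
    Finset.sum_ite_eq', Finset.mem_univ, if_true, Finset.mul_sum, Finset.sum_mul]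
  rw [Finset.sum_comm, Finset.sum_comm (s := Finset.univ (α := ι)) (t := Finset.univ (α := ι))
    (f := fun j k => ∑ i, Y j * (riemann G i k i j x * Z k))]
  refine Finset.sum_congr rfl fun k _ => ?_
  rw [Finset.sum_comm]
  exact Finset.sum_congr rfl fun _ _ => Finset.sum_congr rfl fun _ _ => by ring

/-- The value `g(R(X, Y) Z, V)` of the curvature tensor. -/
def curvForm (G : (ι → ℝ) → Matrix ι ι ℝ) (x X Y Z V : ι → ℝ) : ℝ :=
  form (G x) (curv G x X Y Z) V

end Curv

namespace IsMetricOn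

variable {G : (ι → ℝ) → Matrix ι ι ℝ} {U : Set (ι → ℝ)} (hG : IsMetricOn G U)
  {x : ι → ℝ} (hx : x ∈ U) (X Y Z V : ι → ℝ)

include hG hx

theorem form_symm : form (G x) X Y = form (G x) Y X :=
  ChartGeometry.form_symm _ _ (hG.symm x hx)

theorem curvForm_single (i j k l : ι) :
    curvForm G x (Pi.single i 1) (Pi.single j 1) (Pi.single k 1) (Pi.single l 1)
      = lowerRiemann G x i j k l := by
  rw [curvForm, hG.form_symm hx]
  rw [form, single_dotProduct, one_mul]
  simp only [Matrix.mulVec, dotProduct, lowerRiemann, curv_single]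

theorem curvForm_antisymm_left : curvForm G x Y X Z V = -curvForm G x X Y Z V := by
  rw [eq_neg_iff_add_eq_zero]
  refine quadrilinear_eq_zero_of_single (B := fun X Y Z V => curvForm G x Y X Z V +
    curvForm G x X Y Z V) ?_ ?_ ?_ ?_ (fun i j k l => ?_) X Y Z V
  any_goals
    intros
    constructor <;> intros <;>
    simp only [curvForm, curv_add_left, curv_add_middle, curv_add_right, curv_smul_left,
      curv_smul_middle, curv_smul_right, form_add_left, form_add_right, form_smul_left,
      form_smul_right, smul_eq_mul] <;> ring
  simp only [hG.curvForm_single hx, lowerRiemann_antisymm_left i j k l]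
  ring

theorem curvForm_antisymm_right : curvForm G x X Y V Z = -curvForm G x X Y Z V := by
  rw [eq_neg_iff_add_eq_zero]
  refine quadrilinear_eq_zero_of_single (B := fun X Y Z V => curvForm G x X Y V Z +
    curvForm G x X Y Z V) ?_ ?_ ?_ ?_ (fun i j k l => ?_) X Y Z V
  any_goals
    intros
    constructor <;> intros <;>
    simp only [curvForm, curv_add_left, curv_add_middle, curv_add_right, curv_smul_left,
      curv_smul_middle, curv_smul_right, form_add_left, form_add_right, form_smul_left,
      form_smul_right, smul_eq_mul] <;> ring
  simp only [hG.curvForm_single hx, hG.lowerRiemann_antisymm_right hx i j k l]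
  ring

theorem curvForm_cyclic :
    curvForm G x X Y Z V + curvForm G x Y Z X V + curvForm G x Z X Y V = 0 := by
  refine quadrilinear_eq_zero_of_single (B := fun X Y Z V => curvForm G x X Y Z V +
    curvForm G x Y Z X V + curvForm G x Z X Y V) ?_ ?_ ?_ ?_ (fun i j k l => ?_) X Y Z V
  any_goals
    intros
    constructor <;> intros <;>
    simp only [curvForm, curv_add_left, curv_add_middle, curv_add_right, curv_smul_left,
      curv_smul_middle, curv_smul_right, form_add_left, form_add_right, form_smul_left,
      form_smul_right, smul_eq_mul] <;> ring
  simp only [hG.curvForm_single hx, hG.lowerRiemann_cyclic hx i j k l]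

theorem curvForm_pair_symm : curvForm G x X Y Z V = curvForm G x Z V X Y := by
  rw [← sub_eq_zero]
  refine quadrilinear_eq_zero_of_single (B := fun X Y Z V => curvForm G x X Y Z V -
    curvForm G x Z V X Y) ?_ ?_ ?_ ?_ (fun i j k l => ?_) X Y Z V
  any_goals
    intros
    constructor <;> intros <;>
    simp only [curvForm, curv_add_left, curv_add_middle, curv_add_right, curv_smul_left,
      curv_smul_middle, curv_smul_right, form_add_left, form_add_right, form_smul_left,
      form_smul_right, smul_eq_mul] <;> ring
  simp only [hG.curvForm_single hx, hG.lowerRiemann_pair_symm hx i j k l]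
  ring

theorem form_ricci_mulVec : form (G x) (ricci G x *ᵥ X) Y = Y ⬝ᵥ (ricciForm G x *ᵥ X) := by
  rw [hG.form_symm hx, form, ricci, Matrix.mulVec_mulVec, ← Matrix.mul_assoc,
    Matrix.mul_nonsing_inv _ (hG.isUnit_det x hx), Matrix.one_mul]

end IsMetricOn

/-! ### Ricci tensor in a frame -/

section Frame

variable {G : (ι → ℝ) → Matrix ι ι ℝ} {U : Set (ι → ℝ)} (hG : IsMetricOn G U)
  {x : ι → ℝ} (hx : x ∈ U) {f : ι → ι → ℝ} {η η' : Matrix ι ι ℝ}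
  (hf : ∀ a b, form (G x) (f a) (f b) = η a b) (hη : η' * η = 1)

include hf hη in
-- With the frame vectors as rows of `F`, the Gram relation is `F G Fᵀ = η`. So `η' F G` is a left
-- inverse of the square matrix `Fᵀ`, hence also a right inverse.
theorem frame_mul_eq_one : (Matrix.of f)ᵀ * η' * Matrix.of f * G x = 1 := by
  have h1 : Matrix.of f * G x * (Matrix.of f)ᵀ = η := by
    ext a b
    rw [← hf, Matrix.mul_assoc]
    simp only [form, Matrix.mul_apply, dotProduct, Matrix.mulVec, Matrix.of_apply,
      Matrix.transpose_apply]
  have h2 : (η' * Matrix.of f * G x) * (Matrix.of f)ᵀ = 1 := by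
    rw [Matrix.mul_assoc, Matrix.mul_assoc, ← Matrix.mul_assoc (Matrix.of f), h1, hη]
  rw [mul_eq_one_comm] at h2
  simpa [Matrix.mul_assoc] using h2

include hf hη in
theorem inv_eq_of_frame : (G x)⁻¹ = (Matrix.of f)ᵀ * η' * Matrix.of f :=
  Matrix.inv_eq_left_inv (frame_mul_eq_one hf hη)

include hG hx hf hη in
-- Basis independence of the trace of `Z ↦ R(Z, f b) (f c)`: the rows of `N` are the images of the
-- coordinate vectors, and cycling the trace brings in `Fᵀ η' F`, the inverse metric.
theorem ricciForm_frame (b c : ι) :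
    f b ⬝ᵥ (ricciForm G x *ᵥ f c) =
      ∑ a, ∑ d, η' a d * curvForm G x (f a) (f b) (f c) (f d) := by
  set F : Matrix ι ι ℝ := Matrix.of f with hF
  let N : Matrix ι ι ℝ := Matrix.of fun i => curv G x (Pi.single i 1) (f b) (f c)
  have hcurv : ∀ a, curv G x (f a) (f b) (f c) = f a ᵥ* N := by
    intro a
    ext l
    simp only [curv, Matrix.vecMul, dotProduct, N, Matrix.of_apply, curv, Pi.single_apply,
      mul_ite, ite_mul, mul_one, mul_zero, zero_mul, Finset.sum_ite_irrel, Finset.sum_const_zero,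
      Finset.sum_ite_eq', Finset.mem_univ, if_true, Finset.mul_sum]
    rw [Finset.sum_comm]
    exact Finset.sum_congr rfl fun _ _ => Finset.sum_congr rfl fun _ _ =>
      Finset.sum_congr rfl fun _ _ => by ring
  have hGt : (G x)ᵀ = G x := by ext i j; exact hG.symm x hx j i
  have hM : ∀ a d, curvForm G x (f a) (f b) (f c) (f d) = (F * G x * Nᵀ * Fᵀ) d a := by
    intro a d
    rw [curvForm, hG.form_symm hx, hcurv, form, Matrix.mul_assoc, Matrix.mul_assoc,
      ← Matrix.transpose_mul]
    simp only [Matrix.mul_apply, dotProduct, Matrix.mulVec, Matrix.vecMul, hF, Matrix.of_apply,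
      Matrix.transpose_apply]
  have htr : Matrix.trace (η' * (F * G x * Nᵀ * Fᵀ)) = Matrix.trace N := by
    have : η' * (F * G x * Nᵀ * Fᵀ) = (η' * F * G x * Nᵀ) * Fᵀ := by
      simp only [Matrix.mul_assoc]
    rw [this, Matrix.trace_mul_comm]
    have : Fᵀ * (η' * F * G x * Nᵀ) = (Fᵀ * η' * F) * G x * Nᵀ := by
      simp only [Matrix.mul_assoc]
    rw [this, ← inv_eq_of_frame hf hη, Matrix.nonsing_inv_mul _ (hG.isUnit_det x hx),
      Matrix.one_mul, Matrix.trace_transpose]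
  rw [← sum_curv_single_eq_ricciForm]
  simp only [hM]
  exact htr.symm

include hf hη in
theorem scalar_frame :
    scalar G x = ∑ b, ∑ c, η' b c * (f c ⬝ᵥ (ricciForm G x *ᵥ f b)) := by
  have h : ∀ b c, f c ⬝ᵥ (ricciForm G x *ᵥ f b) =
      (Matrix.of f * ricciForm G x * (Matrix.of f)ᵀ) c b := by
    intro b c
    rw [Matrix.mul_assoc]
    simp only [Matrix.mul_apply, dotProduct, Matrix.mulVec, Matrix.of_apply,
      Matrix.transpose_apply]
  simp only [h]
  rw [scalar, ricci, inv_eq_of_frame hf hη, Matrix.mul_assoc, Matrix.mul_assoc,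
    Matrix.trace_mul_comm, Matrix.mul_assoc]
  rfl

end Frame

/-! ### Constant curvature -/

section ConstantCurvature

variable {G : (ι → ℝ) → Matrix ι ι ℝ} {x : ι → ℝ} {c : ℝ}
  (hdet : IsUnit (G x).det)
  (hc : ∀ X Y Z, curv G x X Y Z = (c / 2) • RL (G x) 1 X Y Z)

include hdet hc

/-- In these sign conventions the hypothesis says that the sectional curvature is `-c`. -/
theorem ricci_of_constant_curvature :
    ricci G x = (-(((Fintype.card ι : ℝ) - 1) * c)) • (1 : Matrix ι ι ℝ) := by
  have h : ricciForm G x = (-(((Fintype.card ι : ℝ) - 1) * c)) • G x := by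
    ext j k
    have h1 : ∀ i, riemann G i k i j x =
        c * (G x i k * (Pi.single j 1 : ι → ℝ) i - G x j k) := by
      intro i
      rw [← curv_single, hc]
      simp only [RL, wedge, form_single_single, Matrix.one_mulVec, Pi.smul_apply, Pi.add_apply,
        Pi.sub_apply, smul_eq_mul, Pi.single_eq_same]
      ring
    simp only [ricciForm, Matrix.of_apply, h1, ← Finset.mul_sum, Finset.sum_sub_distrib,
      Matrix.smul_apply, smul_eq_mul]
    simp [Pi.single_apply]
    ring
  rw [ricci, h, Matrix.mul_smul, Matrix.nonsing_inv_mul _ hdet]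

theorem scalar_of_constant_curvature :
    scalar G x = -((Fintype.card ι : ℝ) * ((Fintype.card ι : ℝ) - 1) * c) := by
  rw [scalar, ricci_of_constant_curvature hdet hc]
  simp
  ring

/-- Above dimension two the Schouten tensor is `-(c / 2) id`, so `R_L` cancels `R`; up to dimension
two the value is zero by convention. -/
theorem weyl_of_constant_curvature (X Y Z : ι → ℝ) : weyl G x X Y Z = 0 := by
  unfold weyl
  split_ifs with h
  · rfl
  have h2 : (2 : ℝ) < Fintype.card ι := by exact_mod_cast not_le.mp h
  have hL : schouten G x = (-(c / 2)) • (1 : Matrix ι ι ℝ) := by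
    rw [schouten, scalar_of_constant_curvature hdet hc,
      ricci_of_constant_curvature hdet hc, ← sub_smul, smul_smul]
    congr 1
    have h3 : (Fintype.card ι : ℝ) - 2 ≠ 0 := by linarith
    have h4 : (Fintype.card ι : ℝ) - 1 ≠ 0 := by linarith
    field_simp
    ring
  apply eq_of_form_eq _ _ hdet
  intro V
  rw [hc, hL, form_add_left, form_smul_left, form_RL, form_RL]
  simp only [Matrix.smul_mulVec, Matrix.one_mulVec, form_smul_left, form_zero_left]
  ring

end ConstantCurvature

end ChartGeometry

/-! ### Algebraic curvature tensors in a frame `p, X₁, …, Xₙ, q` -/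

/-- The Gram matrix of a frame `p, X₁, …, Xₙ, q` with `p, q` null, `g(p, q) = 1`, both orthogonal to
all `Xᵢ`, and `g(Xᵢ, Xⱼ) = h i j`. -/
def nullGram {n : ℕ} (h : Matrix (Fin n) (Fin n) ℝ) : Matrix (WalkerIdx n) (WalkerIdx n) ℝ :=
  Matrix.of fun a b =>
    match a, b with
    | Sum.inl _, Sum.inr (Sum.inr _) => 1
    | Sum.inr (Sum.inr _), Sum.inl _ => 1
    | Sum.inr (Sum.inl i), Sum.inr (Sum.inl j) => h i j
    | _, _ => 0

section NullGram

variable {n : ℕ} (h : Matrix (Fin n) (Fin n) ℝ) (i j : Fin n)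

@[simp] theorem nullGram_v_v : nullGram h WalkerIdx.v WalkerIdx.v = 0 := rfl

@[simp] theorem nullGram_v_x : nullGram h WalkerIdx.v (WalkerIdx.x i) = 0 := rfl

@[simp] theorem nullGram_v_u : nullGram h WalkerIdx.v WalkerIdx.u = 1 := rfl

@[simp] theorem nullGram_x_v : nullGram h (WalkerIdx.x i) WalkerIdx.v = 0 := rfl

@[simp] theorem nullGram_x_x : nullGram h (WalkerIdx.x i) (WalkerIdx.x j) = h i j := rfl

@[simp] theorem nullGram_x_u : nullGram h (WalkerIdx.x i) WalkerIdx.u = 0 := rfl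

@[simp] theorem nullGram_u_v : nullGram h WalkerIdx.u WalkerIdx.v = 1 := rfl

@[simp] theorem nullGram_u_x : nullGram h WalkerIdx.u (WalkerIdx.x i) = 0 := rfl

@[simp] theorem nullGram_u_u : nullGram h WalkerIdx.u WalkerIdx.u = 0 := rfl

theorem WalkerIdx.sum_eq (F : WalkerIdx n → ℝ) :
    ∑ a, F a = F WalkerIdx.v + ((∑ i, F (WalkerIdx.x i)) + F WalkerIdx.u) := by
  simp [Fintype.sum_sum_type]

@[elab_as_elim]
theorem WalkerIdx.cases {Q : WalkerIdx n → Prop} (v : Q WalkerIdx.v)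
    (x : ∀ i, Q (WalkerIdx.x i)) (u : Q WalkerIdx.u) : ∀ a, Q a
  | Sum.inl _ => v
  | Sum.inr (Sum.inl i) => x i
  | Sum.inr (Sum.inr _) => u

theorem nullGram_mul {h h' : Matrix (Fin n) (Fin n) ℝ} (hh : h' * h = 1) :
    nullGram h' * nullGram h = 1 := by
  have key : ∀ i j, ∑ k, h' i k * h k j = (1 : Matrix (Fin n) (Fin n) ℝ) i j := fun i j => by
    rw [← hh, Matrix.mul_apply]
  ext a b
  rw [Matrix.mul_apply, WalkerIdx.sum_eq]
  induction a using WalkerIdx.cases <;> induction b using WalkerIdx.cases <;>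
    simp [key, Matrix.one_apply]

end NullGram

/-! ### Contractions with the inverse of `h`. -/

section InverseSums

variable {n : ℕ} {h h' : Matrix (Fin n) (Fin n) ℝ} (hsymm : ∀ i j, h i j = h j i)
  (hh : h' * h = 1)

include hsymm hh in
theorem sum_sum_inv_mul_mul_mul (j k : Fin n) :
    ∑ i, ∑ l, h' i l * (h i k * h j l) = h j k := by
  have key : ∀ i j, ∑ k, h' i k * h k j = (1 : Matrix (Fin n) (Fin n) ℝ) i j := fun i j => by
    rw [← hh, Matrix.mul_apply]
  have : ∀ i, ∑ l, h' i l * (h i k * h j l) = (1 : Matrix (Fin n) (Fin n) ℝ) i j * h i k := by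
    intro i
    rw [← key, Finset.sum_mul]
    exact Finset.sum_congr rfl fun l _ => by rw [hsymm j l]; ring
  simp only [this, Matrix.one_apply, ite_mul, one_mul, zero_mul, Finset.sum_ite_eq',
    Finset.mem_univ, if_true]

include hsymm hh in
theorem sum_sum_inv_mul : ∑ i, ∑ j, h' i j * h i j = n := by
  have key : ∀ i j, ∑ k, h' i k * h k j = (1 : Matrix (Fin n) (Fin n) ℝ) i j := fun i j => by
    rw [← hh, Matrix.mul_apply]
  have : ∀ i, ∑ j, h' i j * h i j = 1 := by
    intro i
    rw [← Matrix.one_apply_eq i, ← key]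
    exact Finset.sum_congr rfl fun l _ => by rw [hsymm i l]
  simp [this]

include hsymm hh in
theorem sum_sum_inv_mul_mul_vec (w : Fin n → ℝ) (k : Fin n) :
    ∑ i, ∑ j, h' i j * (w j * h i k) = w k := by
  have key : ∀ i j, ∑ k, h i k * h' k j = (1 : Matrix (Fin n) (Fin n) ℝ) i j := fun i j => by
    rw [← mul_eq_one_comm.mp hh, Matrix.mul_apply]
  rw [Finset.sum_comm]
  have : ∀ j, ∑ i, h' i j * (w j * h i k) = (1 : Matrix (Fin n) (Fin n) ℝ) k j * w j := by
    intro j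
    rw [← key, Finset.sum_mul]
    exact Finset.sum_congr rfl fun l _ => by rw [hsymm l k]; ring
  simp only [this, Matrix.one_apply, ite_mul, one_mul, zero_mul, Finset.sum_ite_eq,
    Finset.mem_univ, if_true]

end InverseSums

/-- An algebraic curvature tensor `K a b c d = g(R(e_a, e_b) e_c, e_d)` in a frame with Gram matrix
`nullGram h`, such that the null line spanned by `p` is preserved by all `R(X, Y)`. -/
structure IsWalkerCurvature {n : ℕ}
    (K : WalkerIdx n → WalkerIdx n → WalkerIdx n → WalkerIdx n → ℝ) : Prop where
  antisymm_left : ∀ a b c d, K b a c d = -K a b c d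
  antisymm_right : ∀ a b c d, K a b d c = -K a b c d
  pair_symm : ∀ a b c d, K a b c d = K c d a b
  cyclic : ∀ a b c d, K a b c d + K b c a d + K c a b d = 0
  v_v : ∀ a b, K a b WalkerIdx.v WalkerIdx.v = 0
  v_x : ∀ a b i, K a b WalkerIdx.v (WalkerIdx.x i) = 0

/-! ### Ricci, Schouten and Weyl components in the null frame. -/

section FrameWeyl

variable {n : ℕ} (h h' : Matrix (Fin n) (Fin n) ℝ)
  (K : WalkerIdx n → WalkerIdx n → WalkerIdx n → WalkerIdx n → ℝ)

/-- The components of the Ricci tensor in a frame. -/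
def frameRicci (b c : WalkerIdx n) : ℝ := ∑ a, ∑ d, nullGram h' a d * K a b c d

theorem frameRicci_eq (b c : WalkerIdx n) :
    frameRicci h' K b c =
      K WalkerIdx.v b c WalkerIdx.u + ∑ i, ∑ j, h' i j * K (WalkerIdx.x i) b c (WalkerIdx.x j) + K WalkerIdx.u b c WalkerIdx.v := by
  simp only [frameRicci, WalkerIdx.sum_eq, nullGram_v_v, nullGram_v_x, nullGram_v_u, nullGram_x_v,
    nullGram_x_x, nullGram_x_u, nullGram_u_v, nullGram_u_x, nullGram_u_u, zero_mul, one_mul,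
    zero_add, add_zero, Finset.sum_const_zero]
  ring

/-- The scalar curvature in a frame. -/
def frameScalar : ℝ := ∑ b, ∑ c, nullGram h' b c * frameRicci h' K c b

/-- The components of the Schouten tensor in a frame. -/
def frameSchouten (a b : WalkerIdx n) : ℝ :=
  (1 / (n : ℝ)) * (frameRicci h' K b a -
    frameScalar h' K / (2 * ((n : ℝ) + 1)) * nullGram h a b)

/-- The components of the Weyl tensor in a frame. -/
def frameWeyl (a b c d : WalkerIdx n) : ℝ :=
  K a b c d +
    (frameSchouten h h' K a c * nullGram h b d - nullGram h b c * frameSchouten h h' K a d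
      + (nullGram h a c * frameSchouten h h' K b d - frameSchouten h h' K b c * nullGram h a d))

/-- The component `λ` of a curvature tensor in a null frame. -/
def frameLam : ℝ := K WalkerIdx.v WalkerIdx.u WalkerIdx.v WalkerIdx.u

/-- The components `g(v⃗, Xₖ)` of a curvature tensor in a null frame. -/
def frameVec (k : Fin n) : ℝ := -K WalkerIdx.v WalkerIdx.u WalkerIdx.u (WalkerIdx.x k)

end FrameWeyl

namespace IsWalkerCurvature

open WalkerIdx

variable {n : ℕ} {h h' : Matrix (Fin n) (Fin n) ℝ}
  {K : WalkerIdx n → WalkerIdx n → WalkerIdx n → WalkerIdx n → ℝ} (hK : IsWalkerCurvature K)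

include hK

theorem x_v (a b : WalkerIdx n) (i : Fin n) : K a b (x i) v = 0 := by
  rw [hK.antisymm_right, hK.v_x, neg_zero]

theorem self_right (a b c : WalkerIdx n) : K a b c c = 0 := by
  linarith [hK.antisymm_right a b c c]

theorem self_left (a c d : WalkerIdx n) : K a a c d = 0 := by
  linarith [hK.antisymm_left a a c d]

theorem v_x_left (c d : WalkerIdx n) (i : Fin n) : K v (x i) c d = 0 := by
  rw [hK.pair_symm, hK.v_x]

theorem x_v_left (c d : WalkerIdx n) (i : Fin n) : K (x i) v c d = 0 := by
  rw [hK.pair_symm, hK.x_v]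

/-- In the Bianchi identity the other two terms contain `p` and some `Xᵢ` in the first pair. -/
theorem x_x_v_u (i j : Fin n) : K (x i) (x j) v u = 0 := by
  have := hK.cyclic (x i) (x j) v u
  rwa [hK.x_v_left, hK.v_x_left, add_zero, add_zero] at this

theorem x_x_u_v (i j : Fin n) : K (x i) (x j) u v = 0 := by
  rw [hK.antisymm_right, hK.x_x_v_u, neg_zero]

theorem v_u_x_x (i j : Fin n) : K v u (x i) (x j) = 0 := by
  rw [hK.pair_symm, hK.x_x_v_u]

theorem u_v_x_x (i j : Fin n) : K u v (x i) (x j) = 0 := by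
  rw [hK.pair_symm, hK.x_x_u_v]

theorem frameRicci_symm (hsymm' : ∀ i j, h' i j = h' j i) (b c : WalkerIdx n) :
    frameRicci h' K b c = frameRicci h' K c b := by
  have hg : ∀ a d, nullGram h' a d = nullGram h' d a := by
    intro a d
    induction a using WalkerIdx.cases <;> induction d using WalkerIdx.cases <;> simp [hsymm']
  rw [frameRicci, frameRicci, Finset.sum_comm]
  refine Finset.sum_congr rfl fun d _ => Finset.sum_congr rfl fun a _ => ?_
  rw [hg, hK.pair_symm a, hK.antisymm_left d c, hK.antisymm_right d c b a]
  ring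

theorem frameSchouten_v_u (hsymm' : ∀ i j, h' i j = h' j i) :
    frameSchouten h h' K v u = frameSchouten h h' K u v := by
  rw [frameSchouten, frameSchouten, hK.frameRicci_symm hsymm']
  rfl

/-- The Schouten components are never computed from `K`; only the symmetry of the `v, u` entry is
used. Equations containing `p` yield `λ / 2` for `v u`, `-(λ / 2) h` on `E` and `v⃗` for `u x`.
Substituting these into the equations without `p` gives the three conclusions. -/
theorem of_frameWeyl_eq_zero (hsymm' : ∀ i j, h' i j = h' j i)
    (hW : ∀ a b c d, frameWeyl h h' K a b c d = 0) :
    (∀ i j k l, K (x i) (x j) (x k) (x l) = frameLam K * (h i k * h j l - h j k * h i l)) ∧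
    (∀ i j k, K (x i) u (x j) (x k) = frameVec K j * h i k - h i j * frameVec K k) ∧
    (∀ i k, K (x i) u u (x k) = frameSchouten h h' K u u * h i k) := by
  have hvu := hW v u v u
  have hxx : ∀ i j, frameSchouten h h' K (x i) (x j) = -(frameSchouten h h' K v u) * h i j := by
    intro i j
    have := hW v (x i) (x j) u
    simp only [frameWeyl, nullGram_x_u, nullGram_x_x, nullGram_v_x, nullGram_v_u,
      hK.v_x_left] at this
    linarith
  have hux : ∀ k, frameSchouten h h' K u (x k) = frameVec K k := by
    intro k
    have := hW v u u (x k)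
    simp only [frameWeyl, nullGram_u_x, nullGram_u_u, nullGram_v_x, nullGram_v_u] at this
    rw [frameVec]
    linarith
  simp only [frameWeyl, nullGram_u_u, nullGram_u_v, nullGram_v_v, nullGram_v_u,
    ← hK.frameSchouten_v_u hsymm'] at hvu
  have hlam : frameSchouten h h' K v u = frameLam K / 2 := by
    rw [frameLam]
    linarith
  refine ⟨fun i j k l => ?_, fun i j k => ?_, fun i k => ?_⟩
  · have := hW (x i) (x j) (x k) (x l)
    simp only [frameWeyl, nullGram_x_x, hxx, hlam] at this
    linarith
  · have := hW (x i) u (x j) (x k)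
    simp only [frameWeyl, nullGram_x_x, nullGram_u_x, hux] at this
    linarith
  · have := hW (x i) u u (x k)
    simp only [frameWeyl, nullGram_x_x, nullGram_u_x, nullGram_x_u, nullGram_u_u] at this
    linarith

section Ricci

variable (hsymm : ∀ i j, h i j = h j i) (hsymm' : ∀ i j, h' i j = h' j i) (hh : h' * h = 1)

variable
  (hR : ∀ i j k l, K (x i) (x j) (x k) (x l) = frameLam K * (h i k * h j l - h j k * h i l))
  (hP : ∀ i j k, K (x i) u (x j) (x k) = frameVec K j * h i k - h i j * frameVec K k)
  {f : ℝ} (hT : ∀ i k, K (x i) u u (x k) = f * h i k)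

theorem frameRicci_v_v : frameRicci h' K v v = 0 := by
  simp [frameRicci_eq, hK.v_v, hK.self_left, hK.v_x]

theorem frameRicci_v_x (i : Fin n) : frameRicci h' K v (x i) = 0 := by
  simp [frameRicci_eq, hK.x_v, hK.self_left, hK.x_v_left]

theorem frameRicci_v_u : frameRicci h' K v u = frameLam K := by
  have := hK.antisymm_left v u u v
  have := hK.antisymm_right v u v u
  simp [frameRicci_eq, hK.self_left, hK.x_v_left, frameLam]
  linarith

include hsymm hh hR in
-- The terms with `p` and `q` drop out, so this is the Ricci tensor of constant curvature `-λ` on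
-- `E`.
theorem frameRicci_x_x (j k : Fin n) :
    frameRicci h' K (x j) (x k) = -(((n : ℝ) - 1) * frameLam K * h j k) := by
  have h1 : ∀ i l, h' i l * (frameLam K * (h i k * h j l - h j k * h i l)) =
      frameLam K * (h' i l * (h i k * h j l)) - frameLam K * h j k * (h' i l * h i l) :=
    fun i l => by ring
  simp only [frameRicci_eq, hK.v_x_left, hK.x_v, hR, h1, Finset.sum_sub_distrib,
    ← Finset.mul_sum, sum_sum_inv_mul_mul_mul hsymm hh, sum_sum_inv_mul hsymm hh]
  ring

include hsymm hh hP in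
theorem frameRicci_u_x (k : Fin n) : frameRicci h' K u (x k) = n * frameVec K k := by
  have h1 : ∀ i j, h' i j * (frameVec K k * h i j - h i k * frameVec K j) =
      frameVec K k * (h' i j * h i j) - h' i j * (frameVec K j * h i k) :=
    fun i l => by ring
  have h2 : K v u (x k) u = frameVec K k := hK.antisymm_right v u u (x k)
  simp only [frameRicci_eq, hP, h1, h2, Finset.sum_sub_distrib, ← Finset.mul_sum,
    sum_sum_inv_mul_mul_vec hsymm hh, sum_sum_inv_mul hsymm hh, hK.self_left]
  ring

include hsymm hh hT in
theorem frameRicci_u_u : frameRicci h' K u u = n * f := by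
  have h1 : ∀ i j, h' i j * (f * h i j) = f * (h' i j * h i j) := fun i l => by ring
  simp only [frameRicci_eq, hT, h1, ← Finset.mul_sum, sum_sum_inv_mul hsymm hh, hK.self_left,
    hK.self_right]
  ring

include hsymm hsymm' hh hR in
-- The pair `p, q` contributes `2λ` and `E` contributes `-n(n - 1)λ`.
theorem frameScalar_eq :
    frameScalar h' K = (2 - (n : ℝ)) * ((n : ℝ) + 1) * frameLam K := by
  have h1 : ∀ i j, h' i j * -(((n : ℝ) - 1) * frameLam K * h j i) =
      -(((n : ℝ) - 1) * frameLam K) * (h' i j * h i j) := fun i j => by rw [hsymm j i]; ring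
  simp only [frameScalar, WalkerIdx.sum_eq, nullGram_v_v, nullGram_v_x, nullGram_v_u, nullGram_x_v,
    nullGram_x_x, nullGram_x_u, nullGram_u_v, nullGram_u_x, nullGram_u_u, zero_mul, one_mul,
    zero_add, add_zero, Finset.sum_const_zero, hK.frameRicci_symm hsymm' u v, hK.frameRicci_v_u,
    hK.frameRicci_x_x hsymm hh hR, h1, ← Finset.mul_sum, sum_sum_inv_mul hsymm hh]
  ring

include hsymm hsymm' hh hR hP hT in
-- The Ricci components make the Schouten tensor `λ / 2` on `p, q`, `-(λ / 2) h` on `E`, `v⃗` on `q,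
-- Xᵢ`, `f` on `q, q` and zero elsewhere; division by `n` is where `n ≠ 0` enters.
theorem frameWeyl_eq_zero (hn : n ≠ 0) (a b c d : WalkerIdx n) :
    frameWeyl h h' K a b c d = 0 := by
  have hn0 : (n : ℝ) ≠ 0 := by exact_mod_cast hn
  have hn1 : (n : ℝ) + 1 ≠ 0 := by positivity
  have hs : frameScalar h' K / (2 * ((n : ℝ) + 1)) = (2 - (n : ℝ)) * frameLam K / 2 := by
    rw [hK.frameScalar_eq hsymm hsymm' hh hR]
    field_simp
  have hric := hK.frameRicci_symm hsymm'
  have hvv : frameSchouten h h' K v v = 0 := by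
    simp [frameSchouten, hK.frameRicci_v_v]
  have hvx : ∀ i, frameSchouten h h' K v (x i) = 0 := fun i => by
    simp [frameSchouten, hric (x i) v, hK.frameRicci_v_x]
  have hxv : ∀ i, frameSchouten h h' K (x i) v = 0 := fun i => by
    simp [frameSchouten, hK.frameRicci_v_x]
  have huv : frameSchouten h h' K u v = frameLam K / 2 := by
    simp only [frameSchouten, hK.frameRicci_v_u, hs, nullGram_u_v]
    field_simp
    ring
  have hvu : frameSchouten h h' K v u = frameLam K / 2 := by
    rw [hK.frameSchouten_v_u hsymm', huv]
  have hxx : ∀ i j, frameSchouten h h' K (x i) (x j) = -(frameLam K / 2) * h i j := fun i j => by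
    simp only [frameSchouten, hK.frameRicci_x_x hsymm hh hR, hs, nullGram_x_x, hsymm j i]
    field_simp
    ring
  have hxu : ∀ i, frameSchouten h h' K (x i) u = frameVec K i := fun i => by
    simp only [frameSchouten, hK.frameRicci_u_x hsymm hh hP, nullGram_x_u]
    field_simp
    ring
  have hux : ∀ i, frameSchouten h h' K u (x i) = frameVec K i := fun i => by
    rw [← hxu, frameSchouten, frameSchouten, hric]
    rfl
  have huu : frameSchouten h h' K u u = f := by
    simp only [frameSchouten, hK.frameRicci_u_u hsymm hh hT, nullGram_u_u]
    field_simp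
    ring
  -- The curvature symmetries now supply the remaining possibly nonzero components, so that every
  -- choice of index types can be evaluated.
  have k1 : ∀ i j k, K u (x i) (x j) (x k) = -(frameVec K j * h i k - h i j * frameVec K k) :=
    fun i j k => by rw [hK.antisymm_left, hP]
  have k2 : ∀ i j k, K (x j) (x k) (x i) u = frameVec K j * h i k - h i j * frameVec K k :=
    fun i j k => by rw [hK.pair_symm, hP]
  have k3 : ∀ i j k, K (x j) (x k) u (x i) = -(frameVec K j * h i k - h i j * frameVec K k) :=
    fun i j k => by rw [hK.antisymm_right, k2]
  have k4 : ∀ i k, K u (x i) u (x k) = -(f * h i k) := fun i k => by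
    rw [hK.antisymm_left, hT]
  have k5 : ∀ i k, K (x i) u (x k) u = -(f * h i k) := fun i k => by
    rw [hK.antisymm_right, hT]
  have k6 : ∀ i k, K u (x i) (x k) u = f * h i k := fun i k => by
    rw [hK.antisymm_left, k5, neg_neg]
  have k7 : K v u v u = frameLam K := rfl
  have k8 : K v u u v = -frameLam K := hK.antisymm_right v u v u
  have k9 : K u v v u = -frameLam K := hK.antisymm_left v u v u
  have k10 : K u v u v = frameLam K := by rw [hK.antisymm_left, k8, neg_neg]
  have k11 : ∀ i, K v u u (x i) = -frameVec K i := fun i => by simp [frameVec]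
  have k12 : ∀ i, K v u (x i) u = frameVec K i := fun i => by rw [hK.antisymm_right, k11, neg_neg]
  have k13 : ∀ i, K u v u (x i) = frameVec K i := fun i => by rw [hK.antisymm_left, k11, neg_neg]
  have k14 : ∀ i, K u v (x i) u = -frameVec K i := fun i => by rw [hK.antisymm_left, k12]
  have k15 : ∀ i, K u (x i) v u = -frameVec K i := fun i => by rw [hK.pair_symm, k11]
  have k16 : ∀ i, K (x i) u v u = frameVec K i := fun i => by rw [hK.pair_symm, k12]
  have k17 : ∀ i, K u (x i) u v = frameVec K i := fun i => by rw [hK.pair_symm, k13]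
  have k18 : ∀ i, K (x i) u u v = -frameVec K i := fun i => by rw [hK.pair_symm, k14]
  induction a using WalkerIdx.cases <;> induction b using WalkerIdx.cases <;>
    induction c using WalkerIdx.cases <;> induction d using WalkerIdx.cases <;>
    simp only [frameWeyl, hvv, hvx, hxv, huv, hvu, hxx, hxu, hux, huu, k1, k2, k3, k4, k5, k6, k7,
      k8, k9, k10, k11, k12, k13, k14, k15, k16, k17, k18, hR, hP, hT, hK.v_x, hK.x_v,
      hK.v_x_left, hK.x_v_left, hK.self_left, hK.self_right, hK.x_x_u_v, hK.x_x_v_u, hK.v_u_x_x,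
      hK.u_v_x_x, nullGram_v_v, nullGram_v_x, nullGram_v_u, nullGram_x_v, nullGram_x_x,
      nullGram_x_u, nullGram_u_v, nullGram_u_x, nullGram_u_u] <;>
    (try simp only [hsymm]) <;> ring

end Ricci

end IsWalkerCurvature

/-! ### The Walker metric and its inverse, seen through the null frame. -/

namespace WalkerMetric

open ChartGeometry Filter Topology

variable {n : ℕ} (M : WalkerMetric n)

/-- The frame `p, X₁, …, Xₙ, q`. -/
def fullFrame (z : WalkerIdx n → ℝ) : WalkerIdx n → WalkerIdx n → ℝ
  | Sum.inl _ => p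
  | Sum.inr (Sum.inl i) => M.frame z i
  | Sum.inr (Sum.inr _) => M.q z

variable {z : WalkerIdx n → ℝ}

section Metric

theorem metric_v_v : M.metric z WalkerIdx.v WalkerIdx.v = 0 := rfl

theorem metric_v_x (i : Fin n) : M.metric z WalkerIdx.v (WalkerIdx.x i) = 0 := rfl

theorem metric_v_u : M.metric z WalkerIdx.v WalkerIdx.u = 1 := rfl

theorem metric_x_v (i : Fin n) : M.metric z (WalkerIdx.x i) WalkerIdx.v = 0 := rfl

theorem metric_x_x (i j : Fin n) :
    M.metric z (WalkerIdx.x i) (WalkerIdx.x j) = M.hAt z i j := rfl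

theorem metric_x_u (i : Fin n) :
    M.metric z (WalkerIdx.x i) WalkerIdx.u = M.A (xPart z) (uPart z) i := rfl

theorem metric_u_v : M.metric z WalkerIdx.u WalkerIdx.v = 1 := rfl

theorem metric_u_x (i : Fin n) :
    M.metric z WalkerIdx.u (WalkerIdx.x i) = M.A (xPart z) (uPart z) i := rfl

theorem metric_u_u : M.metric z WalkerIdx.u WalkerIdx.u = M.H z := rfl

theorem form_fullFrame (a b : WalkerIdx n) :
    form (M.metric z) (M.fullFrame z a) (M.fullFrame z b) = nullGram (M.hAt z) a b := by
  induction a using WalkerIdx.cases <;> induction b using WalkerIdx.cases <;>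
    simp only [fullFrame, p, q, frame, form_sub_left, form_sub_right, form_smul_left,
      form_smul_right, form_single_single, metric_v_v, metric_v_x, metric_v_u, metric_x_v,
      metric_x_x, metric_x_u, metric_u_v, metric_u_x, metric_u_u, nullGram_v_v, nullGram_v_x,
      nullGram_v_u, nullGram_x_v, nullGram_x_x, nullGram_x_u, nullGram_u_v, nullGram_u_x,
      nullGram_u_u] <;>
    ring

variable {M} (hz : z ∈ M.U)

include hz

theorem hAt_symm (i j : Fin n) : M.hAt z i j = M.hAt z j i :=
  ((M.posDef_h z hz).isHermitian.apply i j).symm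

theorem isUnit_det_hAt : IsUnit (M.hAt z).det :=
  (M.posDef_h z hz).det_pos.ne'.isUnit

theorem hAt_inv_mul : (M.hAt z)⁻¹ * M.hAt z = 1 :=
  Matrix.nonsing_inv_mul _ (isUnit_det_hAt hz)

theorem hAt_inv_symm (i j : Fin n) : (M.hAt z)⁻¹ i j = (M.hAt z)⁻¹ j i := by
  have h : (M.hAt z)ᵀ = M.hAt z := by ext a b; exact hAt_symm hz b a
  conv_lhs => rw [← h, ← Matrix.transpose_nonsing_inv, Matrix.transpose_apply]

omit hz in
variable (M) in
theorem isMetricOn : IsMetricOn M.metric M.U where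
  isOpen := M.isOpen_U
  symm y hy i j := by
    induction i using WalkerIdx.cases <;> induction j using WalkerIdx.cases <;>
      first | rfl | exact hAt_symm hy _ _
  isUnit_det y hy := by
    have h := frame_mul_eq_one (M.form_fullFrame (z := y)) (nullGram_mul (hAt_inv_mul hy))
    exact Matrix.isUnit_det_of_left_inverse h
  smooth i j := by
    induction i using WalkerIdx.cases <;> induction j using WalkerIdx.cases <;>
      first
        | exact contDiffOn_const
        | exact M.smooth_h _ _
        | exact M.smooth_A _
        | exact M.smooth_H

theorem metric_inv_eq : (M.metric z)⁻¹ =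
    (Matrix.of (M.fullFrame z))ᵀ * nullGram (M.hAt z)⁻¹ * Matrix.of (M.fullFrame z) :=
  inv_eq_of_frame M.form_fullFrame (nullGram_mul (hAt_inv_mul hz))

theorem metric_inv_u (a : WalkerIdx n) :
    (M.metric z)⁻¹ WalkerIdx.u a = (Pi.single WalkerIdx.v 1 : WalkerIdx n → ℝ) a := by
  rw [metric_inv_eq hz]
  simp [Matrix.mul_apply, WalkerIdx.sum_eq, fullFrame, p, q, frame, -Fintype.sum_sum_type]

theorem metric_inv_x_u (k : Fin n) : (M.metric z)⁻¹ (WalkerIdx.x k) WalkerIdx.u = 0 := by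
  rw [metric_inv_eq hz]
  simp [Matrix.mul_apply, WalkerIdx.sum_eq, fullFrame, p, q, frame, -Fintype.sum_sum_type]

theorem metric_inv_x_x (k l : Fin n) :
    (M.metric z)⁻¹ (WalkerIdx.x k) (WalkerIdx.x l) = (M.hAt z)⁻¹ k l := by
  rw [metric_inv_eq hz]
  simp [Matrix.mul_apply, WalkerIdx.sum_eq, fullFrame, p, q, frame, Pi.single_apply,
    -Fintype.sum_sum_type]

end Metric

/-! ### The Levi-Civita connection -/

section Connection

theorem xPart_add_smul_single_v (t : ℝ) :
    xPart (z + t • Pi.single WalkerIdx.v 1) = xPart z := by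
  ext i
  simp [xPart]

theorem uPart_add_smul_single_v (t : ℝ) :
    uPart (z + t • Pi.single WalkerIdx.v 1) = uPart z := by
  simp [uPart]

theorem pderiv_metric_v_right (k a : WalkerIdx n) :
    pderiv k (fun y => M.metric y a WalkerIdx.v) z = 0 := by
  induction a using WalkerIdx.cases <;> exact pderiv_const _ _

/-- Only the entry `H` of the metric depends on `v`. -/
theorem pderiv_v_metric {a b : WalkerIdx n} (hab : a ≠ WalkerIdx.u ∨ b ≠ WalkerIdx.u) :
    pderiv WalkerIdx.v (fun y => M.metric y a b) z = 0 := by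
  refine pderiv_eq_zero_of_translation_invariant _ fun t => ?_
  induction a using WalkerIdx.cases <;> induction b using WalkerIdx.cases <;>
    simp_all [metric, xPart_add_smul_single_v, uPart_add_smul_single_v]

theorem lowerChristoffel_v {a b : WalkerIdx n} (hab : a ≠ WalkerIdx.u ∨ b ≠ WalkerIdx.u) :
    lowerChristoffel M.metric WalkerIdx.v a b z = 0 := by
  simp [lowerChristoffel, pderiv_metric_v_right, pderiv_v_metric M hab]

variable {M} (hz : z ∈ M.U)

include hz

/-- The `u` row of the inverse metric is the coordinate vector of `v`, so raising gives the lowered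
symbol with index `v`. -/
theorem christoffel_u {a b : WalkerIdx n} (hab : a ≠ WalkerIdx.u ∨ b ≠ WalkerIdx.u) :
    christoffel M.metric WalkerIdx.u a b z = 0 := by
  simp [christoffel_eq_sum, metric_inv_u hz, WalkerIdx.sum_eq, lowerChristoffel_v M hab,
    -Fintype.sum_sum_type]

theorem christoffel_x {a b : WalkerIdx n} (hab : a ≠ WalkerIdx.u ∨ b ≠ WalkerIdx.u) (k : Fin n) :
    christoffel M.metric (WalkerIdx.x k) a b z =
      ∑ l, (M.hAt z)⁻¹ k l * lowerChristoffel M.metric (WalkerIdx.x l) a b z := by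
  simp [christoffel_eq_sum, metric_inv_x_u hz, metric_inv_x_x hz, WalkerIdx.sum_eq,
    lowerChristoffel_v M hab, -Fintype.sum_sum_type]

theorem christoffel_x_v (k : Fin n) (a : WalkerIdx n) :
    christoffel M.metric (WalkerIdx.x k) a WalkerIdx.v z = 0 := by
  have h : ∀ l, lowerChristoffel M.metric (WalkerIdx.x l) a WalkerIdx.v z = 0 := by
    intro l
    have h1 : pderiv a (fun y => M.metric y WalkerIdx.v (WalkerIdx.x l)) z = 0 := pderiv_const _ _
    have h2 : pderiv WalkerIdx.v (fun y => M.metric y a (WalkerIdx.x l)) z = 0 :=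
      pderiv_v_metric M (by simp)
    simp [lowerChristoffel, pderiv_metric_v_right, h1, h2]
  rw [christoffel_x hz (by simp)]
  simp [h]

/-- This is `∇p = θ ⊗ p` for a one-form `θ`, in coordinates. -/
theorem christoffel_v_right {k : WalkerIdx n} (hk : k ≠ WalkerIdx.v) (a : WalkerIdx n) :
    christoffel M.metric k a WalkerIdx.v z = 0 := by
  induction k using WalkerIdx.cases with
  | v => exact absurd rfl hk
  | x k => exact christoffel_x_v hz k a
  | u => exact christoffel_u hz (by simp)

theorem pderiv_eq_zero_of_eqOn {f : (WalkerIdx n → ℝ) → ℝ} (hf : ∀ y ∈ M.U, f y = 0)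
    (a : WalkerIdx n) : pderiv a f z = 0 := by
  rw [← pderiv_const (x := z) a 0]
  exact pderiv_congr a (by filter_upwards [M.isOpen_U.mem_nhds hz] with y hy using hf y hy)

/-- The line spanned by `p` is parallel. -/
theorem riemann_v {k : WalkerIdx n} (hk : k ≠ WalkerIdx.v) (a b : WalkerIdx n) :
    riemann M.metric k WalkerIdx.v a b z = 0 := by
  -- Either `m = v` and the first factor vanishes, or `m ≠ v` and the second does.
  have h : ∀ a b m, christoffel M.metric k a m z * christoffel M.metric m b WalkerIdx.v z = 0 := by
    intro a b m
    by_cases hm : m = WalkerIdx.v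
    · rw [hm, christoffel_v_right hz hk, zero_mul]
    · rw [christoffel_v_right hz hm, mul_zero]
  simp only [riemann, h, sub_zero, Finset.sum_const_zero, add_zero,
    pderiv_eq_zero_of_eqOn hz fun y hy => christoffel_v_right hy hk _]

end Connection

/-! ### The slices `u = const` -/

section Slice

/-- The point with the coordinates `v, u` of `z` and coordinates `xⁱ` given by `y`. -/
def slice (z : WalkerIdx n → ℝ) (y : Fin n → ℝ) : WalkerIdx n → ℝ
  | Sum.inl _ => z WalkerIdx.v
  | Sum.inr (Sum.inl i) => y i
  | Sum.inr (Sum.inr _) => z WalkerIdx.u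

theorem slice_xPart (z : WalkerIdx n → ℝ) : slice z (xPart z) = z := by
  ext a
  induction a using WalkerIdx.cases <;> rfl

theorem slice_xPart_add (z : WalkerIdx n → ℝ) (i : Fin n) (t : ℝ) :
    slice z (xPart z + t • Pi.single i 1) = z + t • Pi.single (WalkerIdx.x i) 1 := by
  ext a
  induction a using WalkerIdx.cases <;> simp [slice, xPart, Pi.single_apply]

theorem differentiable_slice (z : WalkerIdx n → ℝ) : Differentiable ℝ (slice z) := by
  rw [differentiable_pi]
  intro a
  induction a using WalkerIdx.cases <;> simp only [slice] <;> fun_prop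

/-- Both sides are line derivatives along the same coordinate line. -/
theorem pderiv_slice {F : (WalkerIdx n → ℝ) → ℝ} (hF : DifferentiableAt ℝ F z) (i : Fin n) :
    pderiv i (fun y => F (slice z y)) (xPart z) = pderiv (WalkerIdx.x i) F z := by
  have h : DifferentiableAt ℝ (fun y => F (slice z y)) (xPart z) := by
    refine DifferentiableAt.comp (xPart z) ?_ (differentiable_slice z _)
    rwa [slice_xPart]
  rw [pderiv, pderiv, ← h.lineDeriv_eq_fderiv, ← hF.lineDeriv_eq_fderiv, lineDeriv, lineDeriv]
  simp only [slice_xPart_add]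

variable {M} (hz : z ∈ M.U)

include hz

theorem christoffel_x_x_x (k i j : Fin n) :
    christoffel M.metric (WalkerIdx.x k) (WalkerIdx.x i) (WalkerIdx.x j) z =
      christoffel (fun y => M.h y (uPart z)) k i j (xPart z) := by
  have h : ∀ a b c, pderiv c (fun y => M.h y (uPart z) a b) (xPart z) =
      pderiv (WalkerIdx.x c) (fun y => M.metric y (WalkerIdx.x a) (WalkerIdx.x b)) z := fun a b c =>
    pderiv_slice (F := fun y => M.metric y (WalkerIdx.x a) (WalkerIdx.x b))
      (M.isMetricOn.differentiableAt hz _ _) c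
  rw [christoffel_x hz (by simp), christoffel_eq_sum]
  simp only [lowerChristoffel, h]
  rfl

/-- In the quadratic terms the summation index may be restricted to the `x` directions: `m = v` is
killed by `christoffel_x_v`, and `m = u` by `christoffel_u`. -/
theorem riemann_x_x_x_x (l k i j : Fin n) :
    riemann M.metric (WalkerIdx.x l) (WalkerIdx.x k) (WalkerIdx.x i) (WalkerIdx.x j) z =
      riemann (fun y => M.h y (uPart z)) l k i j (xPart z) := by
  -- The Christoffel symbols are to be differentiated, so their agreement is needed near the point,
  -- not only at it.
  have hev : ∀ᶠ y in 𝓝 (xPart z), slice z y ∈ M.U := by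
    apply (differentiable_slice z).continuous.continuousAt.eventually_mem
    rw [slice_xPart]
    exact M.isOpen_U.mem_nhds hz
  have h : ∀ c k i j, pderiv (WalkerIdx.x c)
      (christoffel M.metric (WalkerIdx.x k) (WalkerIdx.x i) (WalkerIdx.x j)) z =
      pderiv c (christoffel (fun y => M.h y (uPart z)) k i j) (xPart z) := by
    intro c k i j
    rw [← pderiv_slice (M.isMetricOn.differentiableAt_christoffel hz _ _ _)]
    exact pderiv_congr c (by filter_upwards [hev] with y hy using christoffel_x_x_x hy k i j)
  simp only [riemann, h, WalkerIdx.sum_eq, christoffel_x_x_x hz, christoffel_x_v hz,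
    christoffel_u hz (a := WalkerIdx.x _) (b := WalkerIdx.x _) (Or.inl (by simp)), zero_mul,
    mul_zero, sub_zero, zero_add, add_zero]

end Slice

end WalkerMetric

namespace WalkerMetric

open ChartGeometry

variable {n : ℕ} (M : WalkerMetric n) {z : WalkerIdx n → ℝ}

/-! ### The curvature tensor in the frame `p, X₁, …, Xₙ, q` -/

/-- The components of the curvature tensor in the frame `p, X₁, …, Xₙ, q`. -/
def frameCurv (z : WalkerIdx n → ℝ) (a b c d : WalkerIdx n) : ℝ :=
  curvForm M.metric z (M.fullFrame z a) (M.fullFrame z b) (M.fullFrame z c) (M.fullFrame z d)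

theorem form_p (X : WalkerIdx n → ℝ) : form (M.metric z) p X = X WalkerIdx.u := by
  simp [form, p, Matrix.mulVec, dotProduct, metric_v_v, metric_v_x, metric_v_u, WalkerIdx.sum_eq,
    -Fintype.sum_sum_type]

theorem vec_add (X Y : Fin n → ℝ) : M.vec z (X + Y) = M.vec z X + M.vec z Y := by
  simp [vec, add_smul, Finset.sum_add_distrib]

theorem vec_smul (c : ℝ) (X : Fin n → ℝ) : M.vec z (c • X) = c • M.vec z X := by
  simp [vec, mul_smul, Finset.smul_sum]

theorem vec_single (i : Fin n) : M.vec z (Pi.single i 1) = M.frame z i := by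
  simp [vec, Pi.single_apply]

variable {M} (hz : z ∈ M.U)

include hz

theorem curv_p_eq_smul (X Y : WalkerIdx n → ℝ) :
    curv M.metric z X Y p = curv M.metric z X Y p WalkerIdx.v • p := by
  have h : ∀ l, l ≠ WalkerIdx.v → curv M.metric z X Y p l = 0 := by
    intro l hl
    simp only [curv, p, Pi.single_apply, mul_ite, ite_mul, mul_one, mul_zero, zero_mul,
      Finset.sum_ite_irrel, Finset.sum_const_zero, Finset.sum_ite_eq', Finset.mem_univ, if_true,
      riemann_v hz hl]
  ext l
  by_cases hl : l = WalkerIdx.v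
  · simp [hl, p]
  · rw [h l hl]
    simp [p, hl]

theorem curvForm_p_right (X Y : WalkerIdx n → ℝ) {V : WalkerIdx n → ℝ} (hV : V WalkerIdx.u = 0) :
    curvForm M.metric z X Y p V = 0 := by
  rw [curvForm, curv_p_eq_smul hz, form_smul_left, form_p, hV, mul_zero]

/-- By `form_p` the condition on `X` is orthogonality to `p`; pair symmetry moves `p` into the
second pair. -/
theorem curvForm_p_left {X : WalkerIdx n → ℝ} (hX : X WalkerIdx.u = 0) (Y V : WalkerIdx n → ℝ) :
    curvForm M.metric z p X Y V = 0 := by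
  rw [M.isMetricOn.curvForm_pair_symm hz, curvForm_p_right hz _ _ hX]

theorem isWalkerCurvature_frameCurv : IsWalkerCurvature (M.frameCurv z) where
  antisymm_left _ _ _ _ := M.isMetricOn.curvForm_antisymm_left hz _ _ _ _
  antisymm_right _ _ _ _ := M.isMetricOn.curvForm_antisymm_right hz _ _ _ _
  pair_symm _ _ _ _ := M.isMetricOn.curvForm_pair_symm hz _ _ _ _
  cyclic _ _ _ _ := M.isMetricOn.curvForm_cyclic hz _ _ _ _
  v_v _ _ := curvForm_p_right hz _ _ (by simp [fullFrame, p])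
  v_x _ _ _ := curvForm_p_right hz _ _ (by simp [fullFrame, frame])

omit hz in
variable (M) in
theorem form_frame (Y : WalkerIdx n → ℝ) (l : Fin n) :
    form (M.metric z) Y (M.frame z l) = ∑ m, M.hAt z m l * Y (WalkerIdx.x m) := by
  rw [frame, form_sub_right, form_smul_right]
  simp only [form, dotProduct, Matrix.mulVec_single_one, Matrix.col_apply, WalkerIdx.sum_eq,
    metric_v_v, metric_v_x, metric_x_v, metric_x_x, metric_u_v, metric_u_x,
    mul_comm (Y _), zero_mul, Finset.sum_const_zero]
  ring

/-- Since `Xᵢ = ∂ᵢ - Aᵢ p`, replacing `Xᵢ` by `∂ᵢ` in the first three slots adds only terms with `p`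
paired against vectors orthogonal to `p`, which vanish. The last slot stays `Xₗ`, so that lowering
uses `h` alone. -/
theorem frameCurv_x_x_x_x (i j k l : Fin n) :
    M.frameCurv z (WalkerIdx.x i) (WalkerIdx.x j) (WalkerIdx.x k) (WalkerIdx.x l) =
      form (M.hAt z) (M.R₀ z (Pi.single i 1) (Pi.single j 1) (Pi.single k 1)) (Pi.single l 1) := by
  have hu : ∀ i, M.frame z i WalkerIdx.u = 0 := fun i => by simp [frame]
  have hf : ∀ i, M.frame z i =
      Pi.single (WalkerIdx.x i) 1 + (-M.A (xPart z) (uPart z) i) • p := fun i => by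
    rw [frame, neg_smul, sub_eq_add_neg, p]
  have h1 : ∀ X Y, curvForm M.metric z (M.frame z i) (M.frame z j) X Y =
      curvForm M.metric z (Pi.single (WalkerIdx.x i) 1) (Pi.single (WalkerIdx.x j) 1) X Y := by
    intro X Y
    have hp := curvForm_p_left hz (hu j) X Y
    have hp' := curvForm_p_left (X := Pi.single (WalkerIdx.x i) 1) hz (by simp) X Y
    rw [M.isMetricOn.curvForm_antisymm_left hz, neg_eq_zero] at hp'
    rw [curvForm] at hp hp'
    rw [curvForm, hf i, curv_add_left, curv_smul_left, form_add_left, form_smul_left, hp, mul_zero,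
      add_zero, hf j, curv_add_middle, curv_smul_middle, form_add_left, form_smul_left, hp',
      mul_zero, add_zero, curvForm]
  have h2 : curvForm M.metric z (Pi.single (WalkerIdx.x i) 1) (Pi.single (WalkerIdx.x j) 1)
      (M.frame z k) (M.frame z l) = curvForm M.metric z (Pi.single (WalkerIdx.x i) 1)
        (Pi.single (WalkerIdx.x j) 1) (Pi.single (WalkerIdx.x k) 1) (M.frame z l) := by
    have hp := curvForm_p_right hz (Pi.single (WalkerIdx.x i) 1) (Pi.single (WalkerIdx.x j) 1)
      (hu l)
    rw [curvForm] at hp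
    rw [curvForm, hf k, curv_add_right, curv_smul_right, form_add_left, form_smul_left, hp,
      mul_zero, add_zero, curvForm]
  change curvForm M.metric z (M.frame z i) (M.frame z j) (M.frame z k) (M.frame z l) = _
  rw [h1, h2, curvForm, form_frame]
  simp only [curv_single, riemann_x_x_x_x hz, form, R₀, dotProduct, Matrix.mulVec_single_one,
    Matrix.col_apply, mul_comm]

/-! ### The Weyl tensor in the frame `p, X₁, …, Xₙ, q` -/

theorem form_schouten (a b : WalkerIdx n) :
    form (M.metric z) (schouten M.metric z *ᵥ M.fullFrame z a) (M.fullFrame z b) =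
      frameSchouten (M.hAt z) (M.hAt z)⁻¹ (M.frameCurv z) a b := by
  have hη := nullGram_mul (hAt_inv_mul hz)
  have hric := ricciForm_frame M.isMetricOn hz M.form_fullFrame hη
  have hs := scalar_frame M.form_fullFrame hη
  simp only [hric] at hs
  -- Hence `d - 2 = n` and `d - 1 = n + 1`, the constants in `frameSchouten`.
  have hcard : (Fintype.card (WalkerIdx n) : ℝ) = n + 2 := by
    simp
    ring
  rw [schouten, Matrix.smul_mulVec, Matrix.sub_mulVec, Matrix.smul_mulVec, Matrix.one_mulVec,
    form_smul_left, form_sub_left, form_smul_left, form_fullFrame,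
    M.isMetricOn.form_ricci_mulVec hz, hric, hs, hcard, frameSchouten, frameScalar]
  simp only [frameRicci, frameCurv]
  congr 3
  · ring
  · congr 1
    ring

omit hz in
theorem W_eq (X Y Z : WalkerIdx n → ℝ) (hn : n ≠ 0) : M.W z X Y Z =
    curv M.metric z X Y Z + RL (M.metric z) (schouten M.metric z) X Y Z := by
  rw [W, weyl, if_neg]
  simp
  omega

theorem form_W_fullFrame (hn : n ≠ 0) (a b c d : WalkerIdx n) :
    form (M.metric z) (M.W z (M.fullFrame z a) (M.fullFrame z b) (M.fullFrame z c))
      (M.fullFrame z d) = frameWeyl (M.hAt z) (M.hAt z)⁻¹ (M.frameCurv z) a b c d := by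
  rw [W_eq _ _ _ hn, form_add_left, form_RL]
  simp only [form_schouten hz, form_fullFrame, frameWeyl, frameCurv, curvForm]

theorem exists_eq_vecMul_fullFrame (X : WalkerIdx n → ℝ) :
    ∃ c, X = c ᵥ* Matrix.of (M.fullFrame z) := by
  have h := frame_mul_eq_one (M.form_fullFrame (z := z)) (nullGram_mul (hAt_inv_mul hz))
  rw [mul_eq_one_comm] at h
  refine ⟨X ᵥ* (M.metric z * ((Matrix.of (M.fullFrame z))ᵀ * nullGram (M.hAt z)⁻¹)), ?_⟩
  rw [Matrix.vecMul_vecMul, Matrix.mul_assoc, h, Matrix.vecMul_one]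

theorem forall_W_eq_zero_iff (hn : n ≠ 0) : (∀ X Y Z, M.W z X Y Z = 0) ↔
    ∀ a b c d, frameWeyl (M.hAt z) (M.hAt z)⁻¹ (M.frameCurv z) a b c d = 0 := by
  refine ⟨fun h a b c d => ?_, fun h X Y Z => ?_⟩
  · rw [← form_W_fullFrame hz hn, h, form_zero_left]
  refine eq_of_form_eq _ _ (M.isMetricOn.isUnit_det z hz) fun V => ?_
  obtain ⟨X, rfl⟩ := exists_eq_vecMul_fullFrame hz X
  obtain ⟨Y, rfl⟩ := exists_eq_vecMul_fullFrame hz Y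
  obtain ⟨Z, rfl⟩ := exists_eq_vecMul_fullFrame hz Z
  obtain ⟨V, rfl⟩ := exists_eq_vecMul_fullFrame hz V
  rw [form_zero_left]
  set F := Matrix.of (M.fullFrame z) with hF
  refine quadrilinear_eq_zero_of_single (B := fun X Y Z V => form (M.metric z)
    (M.W z (X ᵥ* F) (Y ᵥ* F) (Z ᵥ* F)) (V ᵥ* F)) ?_ ?_ ?_ ?_ (fun a b c d => ?_) X Y Z V
  any_goals
    intros
    constructor <;> intros <;>
    simp only [W_eq _ _ _ hn, Matrix.add_vecMul, Matrix.smul_vecMul, curv_add_left,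
      curv_add_middle, curv_add_right, curv_smul_left, curv_smul_middle, curv_smul_right,
      form_add_left, form_add_right, form_smul_left, form_smul_right, form_RL, Matrix.mulVec_add,
      Matrix.mulVec_smul, smul_eq_mul] <;> ring
  have hrow : ∀ a, Pi.single a 1 ᵥ* F = M.fullFrame z a := fun a => by
    rw [Matrix.single_one_vecMul]
    rfl
  simp only [hrow, form_W_fullFrame hz hn, h]

/-! ### The components of the curvature tensor in invariant form -/

theorem form_projE (Y : WalkerIdx n → ℝ) (V : Fin n → ℝ) :
    form (M.hAt z) (M.projE z Y) V = form (M.metric z) Y (M.vec z V) := by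
  rw [form_symm _ _ (hAt_symm hz), form, projE, Matrix.mulVec_mulVec,
    Matrix.mul_nonsing_inv _ (isUnit_det_hAt hz), Matrix.one_mulVec, vec, form_sum_right]
  simp only [form_smul_right, dotProduct]

theorem form_vecv (V : Fin n → ℝ) :
    form (M.hAt z) (M.vecv z) V = -curvForm M.metric z p (M.q z) (M.q z) (M.vec z V) := by
  rw [vecv, form_neg_left, form_projE hz, R, curvForm]

theorem form_vecv_single (k : Fin n) :
    form (M.hAt z) (M.vecv z) (Pi.single k 1) = frameVec (M.frameCurv z) k := by
  rw [form_vecv hz, vec_single]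
  rfl

theorem form_P (X Y V : Fin n → ℝ) :
    form (M.hAt z) (M.P z X Y) V =
      curvForm M.metric z (M.vec z X) (M.q z) (M.vec z Y) (M.vec z V) := by
  rw [P, form_projE hz, R, curvForm]

theorem form_T (X V : Fin n → ℝ) :
    form (M.hAt z) (M.T z X) V =
      -curvForm M.metric z (M.vec z X) (M.q z) (M.q z) (M.vec z V) := by
  rw [T, form_neg_left, form_projE hz, R, curvForm]

omit hz in
variable (M) in
theorem lam_eq_frameLam : M.lam z = frameLam (M.frameCurv z) := rfl

theorem forall_P_eq_wedge_iff :
    (∀ X Y, M.P z X Y = wedge (M.hAt z) (M.vecv z) X Y) ↔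
      ∀ i j k, M.frameCurv z (WalkerIdx.x i) WalkerIdx.u (WalkerIdx.x j) (WalkerIdx.x k) =
        frameVec (M.frameCurv z) j * M.hAt z i k - M.hAt z i j * frameVec (M.frameCurv z) k := by
  have key : ∀ i j k, form (M.hAt z) (M.P z (Pi.single i 1) (Pi.single j 1)) (Pi.single k 1) =
      M.frameCurv z (WalkerIdx.x i) WalkerIdx.u (WalkerIdx.x j) (WalkerIdx.x k) := by
    intro i j k
    rw [form_P hz, vec_single, vec_single, vec_single]
    rfl
  refine ⟨fun h i j k => ?_, fun h X Y => ?_⟩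
  · rw [← key, h, form_wedge]
    simp only [form_vecv_single hz, form_single_single]
  refine eq_of_form_eq _ _ (isUnit_det_hAt hz) fun V => sub_eq_zero.mp ?_
  refine trilinear_eq_zero_of_single (B := fun X Y V => form (M.hAt z) (M.P z X Y) V -
    form (M.hAt z) (wedge (M.hAt z) (M.vecv z) X Y) V) ?_ ?_ ?_ (fun i j k => ?_) X Y V
  any_goals
    intros
    constructor <;> intros <;>
    simp only [form_P hz, form_wedge, vec_add, vec_smul, curvForm, curv_add_left,
      curv_add_right, curv_smul_left, curv_smul_right, form_add_left, form_add_right,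
      form_smul_left, form_smul_right, smul_eq_mul] <;> ring
  simp only [form_wedge, form_vecv_single hz, form_single_single, key, h, sub_self]

theorem forall_T_eq_smul_iff (f : ℝ) :
    (∀ X, M.T z X = f • X) ↔
      ∀ i k, M.frameCurv z (WalkerIdx.x i) WalkerIdx.u WalkerIdx.u (WalkerIdx.x k) =
        -f * M.hAt z i k := by
  have key : ∀ i k, form (M.hAt z) (M.T z (Pi.single i 1)) (Pi.single k 1) =
      -M.frameCurv z (WalkerIdx.x i) WalkerIdx.u WalkerIdx.u (WalkerIdx.x k) := by
    intro i k
    rw [form_T hz, vec_single, vec_single]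
    rfl
  refine ⟨fun h i k => ?_, fun h X => ?_⟩
  · have := key i k
    rw [h, form_smul_left, form_single_single] at this
    linarith
  refine eq_of_form_single_eq _ _ (isUnit_det_hAt hz) fun k => sub_eq_zero.mp ?_
  refine IsLinearMap.eq_zero_of_single (f := fun X => form (M.hAt z) (M.T z X) (Pi.single k 1) -
    form (M.hAt z) (f • X) (Pi.single k 1)) ?_ (fun i => ?_) X
  · constructor <;> intros <;>
    simp only [form_T hz, vec_add, vec_smul, curvForm, curv_add_left, curv_smul_left,
      form_add_left, form_smul_left, smul_eq_mul] <;> ring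
  · rw [key, h, form_smul_left, form_single_single]
    ring

theorem forall_R₀_eq_iff :
    (∀ X Y Z, M.R₀ z X Y Z = (M.lam z / 2) • RL (M.hAt z) 1 X Y Z) ↔
      ∀ i j k l, M.frameCurv z (WalkerIdx.x i) (WalkerIdx.x j) (WalkerIdx.x k) (WalkerIdx.x l) =
        frameLam (M.frameCurv z) * (M.hAt z i k * M.hAt z j l - M.hAt z j k * M.hAt z i l) := by
  refine ⟨fun h i j k l => ?_, fun h X Y Z => ?_⟩
  · rw [frameCurv_x_x_x_x hz, h, form_smul_left, form_RL, lam_eq_frameLam]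
    simp only [Matrix.one_mulVec, form_single_single]
    ring
  refine eq_of_form_eq _ _ (isUnit_det_hAt hz) fun V => sub_eq_zero.mp ?_
  refine quadrilinear_eq_zero_of_single (B := fun X Y Z V => form (M.hAt z) (M.R₀ z X Y Z) V -
    form (M.hAt z) ((M.lam z / 2) • RL (M.hAt z) 1 X Y Z) V) ?_ ?_ ?_ ?_ (fun i j k l => ?_) X Y Z V
  any_goals
    intros
    constructor <;> intros <;>
    simp only [R₀, form_RL, Matrix.one_mulVec, curv_add_left, curv_add_middle, curv_add_right,
      curv_smul_left, curv_smul_middle, curv_smul_right, form_add_left, form_add_right,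
      form_smul_left, form_smul_right, smul_eq_mul] <;> ring
  simp only [← frameCurv_x_x_x_x hz, h, form_smul_left, form_RL, lam_eq_frameLam,
    Matrix.one_mulVec, form_single_single]
  ring

/-- Tracing `g(v⃗, Xⱼ) Xᵢ - hᵢⱼ v⃗` with the inverse of `h` gives `v⃗ - n v⃗`. -/
theorem ricP_eq_of_P_eq_wedge (h : ∀ X Y, M.P z X Y = wedge (M.hAt z) (M.vecv z) X Y) :
    M.ricP z = -(((n : ℝ) - 1) • M.vecv z) := by
  refine eq_of_form_single_eq _ _ (isUnit_det_hAt hz) fun l => ?_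
  set w := frameVec (M.frameCurv z) with hw
  have h1 : ∀ i j, (M.hAt z)⁻¹ i j * (w j * M.hAt z i l - M.hAt z i j * w l) =
      (M.hAt z)⁻¹ i j * (w j * M.hAt z i l) - (M.hAt z)⁻¹ i j * M.hAt z i j * w l :=
    fun i j => by ring
  simp only [ricP, form_sum_left, form_smul_left, form_neg_left, h, form_wedge,
    form_vecv_single hz, form_single_single, ← hw, h1, Finset.sum_sub_distrib, ← Finset.sum_mul,
    sum_sum_inv_mul (hAt_symm hz) (hAt_inv_mul hz),
    sum_sum_inv_mul_mul_vec (hAt_symm hz) (hAt_inv_mul hz)]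
  ring

theorem s₀_eq (h : ∀ X Y Z, M.R₀ z X Y Z = (M.lam z / 2) • RL (M.hAt z) 1 X Y Z) :
    M.s₀ z = -((n : ℝ) * ((n : ℝ) - 1) * M.lam z) := by
  have := scalar_of_constant_curvature (G := fun y => M.h y (uPart z)) (x := xPart z)
    (isUnit_det_hAt hz) h
  rwa [Fintype.card_fin] at this

theorem W₀_eq_zero (h : ∀ X Y Z, M.R₀ z X Y Z = (M.lam z / 2) • RL (M.hAt z) 1 X Y Z)
    (X Y Z : Fin n → ℝ) : M.W₀ z X Y Z = 0 :=
  weyl_of_constant_curvature (G := fun y => M.h y (uPart z)) (x := xPart z)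
    (isUnit_det_hAt hz) h X Y Z

/-- The Weyl tensor at a point vanishes iff the curvature components have the stated form. -/
theorem forall_W_eq_zero_iff_components (hn : n ≠ 0) : (∀ X Y Z, M.W z X Y Z = 0) ↔
    (∀ X Y Z, M.R₀ z X Y Z = (M.lam z / 2) • RL (M.hAt z) 1 X Y Z) ∧
    (∀ X Y, M.P z X Y = wedge (M.hAt z) (M.vecv z) X Y) ∧
    ∃ f : ℝ, ∀ X, M.T z X = f • X := by
  have hK := isWalkerCurvature_frameCurv hz
  rw [forall_W_eq_zero_iff hz hn, forall_R₀_eq_iff hz, forall_P_eq_wedge_iff hz]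
  simp only [forall_T_eq_smul_iff hz]
  constructor
  · intro h
    obtain ⟨hR, hP, hT⟩ := hK.of_frameWeyl_eq_zero (hAt_inv_symm hz) h
    -- The factor is minus the `u, u` Schouten component, because of the sign in the definition of
    -- `T`.
    exact ⟨hR, hP, _, fun i k => by rw [hT, neg_neg]⟩
  · rintro ⟨hR, hP, f, hT⟩
    exact hK.frameWeyl_eq_zero (hAt_symm hz) (hAt_inv_symm hz) (hAt_inv_mul hz) hR hP hT hn

end WalkerMetric

end

theorem lemma1 (n : ℕ) (hn : 2 ≤ n) (M : WalkerMetric n) :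
    ((∀ z ∈ M.U, ∀ X Y Z, M.W z X Y Z = 0) ↔
      (∀ z ∈ M.U, M.s₀ z = -((n : ℝ) * ((n : ℝ) - 1) * M.lam z)) ∧
      (∀ z ∈ M.U, ∀ X Y Z,
        M.R₀ z X Y Z = (M.lam z / 2) • ChartGeometry.RL (M.hAt z) 1 X Y Z) ∧
      (∀ z ∈ M.U, ∀ X Y, M.P z X Y = ChartGeometry.wedge (M.hAt z) (M.vecv z) X Y) ∧
      (∃ f : (WalkerIdx n → ℝ) → ℝ, ∀ z ∈ M.U, ∀ X, M.T z X = f z • X)) ∧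
    ((∀ z ∈ M.U, ∀ X Y Z, M.W z X Y Z = 0) →
      (∀ z ∈ M.U, M.ricP z = -(((n : ℝ) - 1) • M.vecv z)) ∧
      (∀ z ∈ M.U, ∀ X Y Z, M.W₀ z X Y Z = 0)) := by
  have key := fun z hz =>
    WalkerMetric.forall_W_eq_zero_iff_components (M := M) (z := z) hz (by omega)
  -- The scalar curvature condition is discarded in the converse: it already follows from the one on
  -- `R₀`.
  refine ⟨⟨fun h => ?_, fun ⟨_, hR, hP, f, hT⟩ z hz => ?_⟩, fun h => ?_⟩
  · refine ⟨fun z hz => WalkerMetric.s₀_eq hz ((key z hz).1 (h z hz)).1,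
      fun z hz => ((key z hz).1 (h z hz)).1, fun z hz => ((key z hz).1 (h z hz)).2.1, ?_⟩
    -- No regularity of `f` is required, so pointwise factors suffice, with arbitrary values off
    -- `U`.
    choose! f hf using fun z hz => ((key z hz).1 (h z hz)).2.2
    exact ⟨f, hf⟩
  · exact (key z hz).2 ⟨hR z hz, hP z hz, f z, hT z hz⟩
  · exact ⟨fun z hz => WalkerMetric.ricP_eq_of_P_eq_wedge hz ((key z hz).1 (h z hz)).2.1,
      fun z hz => WalkerMetric.W₀_eq_zero hz ((key z hz).1 (h z hz)).1⟩
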